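/- Work over $\mathbb{C}$. Let $(V,Y,\mathbf 1)$ be a vertex algebra (defined by truncation, the vacuum and creation properties and the Jacobi identity; no grading is assumed), write $Y(v,z)=\sum_{n\in\mathbb Z}v_nz^{-n-1}$, and assume that $V$ has countable dimension and is simple, i.e. $V$ is irreducible as a module over itself: $V\neq 0$, and the only subspaces stable under all operators $v_n$ ($v\in V$, $n\in\mathbb Z$) are $0$ and $V$. Let $G$ be a finite group of automorphisms of $V$, where an automorphism is an invertible linear map $g$ with $g\mathbf 1=\mathbf 1$ and $gY(v,z)g^{-1}=Y(gv,z)$ for all $v\in V$, and let $V^G$ be the vertex algebra of $G$-fixed points. Let $\Lambda$ be the set of irreducible complex characters of $G$. For $\lambda\in\Lambda$ let $W_\lambda$ be an irreducible representation of $G$ with character $\lambda$, and let $V_\lambda=\operatorname{Hom}_G(W_\lambda,V)$, which is a $V^G$-module via $(v_nf)(w)=v_n(f(w))$ for $v\in V^G$, $n\in\mathbb Z$, $f\in V_\lambda$, $w\in W_\lambda$. Then the actions of $G$ and $V^G$ on $V$ commute, and the map $w\otimes f\mapsto f(w)$ is an isomorphism $$\bigoplus_{\lambda\in\Lambda}W_\lambda\otimes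 V_\lambda\;\cong\;V$$ commuting with the actions of $G$ and of $V^G$, where $G$ acts on the factors $W_\lambda$ and $V^G$ acts on the factors $V_\lambda$. Moreover: (1) $V_\lambda\neq 0$ for every $\lambda\in\Lambda$. (2) Each $V_\lambda$ is an irreducible $V^G$-module. (3) For $\lambda,\mu\in\Lambda$, $V_\lambda$ and $V_\mu$ are isomorphic $V^G$-modules if and only if $\lambda=\mu$. In particular, $V$ is a completely reducible $V^G$-module, i.e. a direct sum of irreducible $V^G$-submodules. -/

import Mathlib

open scoped TensorProduct DirectSum

noncomputable section

universe u v w x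

/-! ### Vertex algebras and their modules

A formal distribution `Y(v,z) = ∑ v_n z^(-n-1)` is stored as the family `n ↦ v_n` of its modes. -/

/-- The Jacobi identity
`z₀⁻¹ δ((z₁-z₂)/z₀) Y_M(a,z₁) Y_M(b,z₂) - z₀⁻¹ δ((z₂-z₁)/(-z₀)) Y_M(b,z₂) Y_M(a,z₁)
  = z₂⁻¹ δ((z₁-z₀)/z₂) Y_M(Y(a,z₀)b,z₂)`,
applied to vectors `c` of `M`, coefficient by coefficient: the equation below compares the
coefficients of `z₀^(-l-1) z₁^(-m-1) z₂^(-n-1)`. On the right-hand side the binomial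
coefficient `(-1)^i * choose (i-m-1) i` of the expansion is written as `choose m i`.
Here `Ring.choose l i` is the generalized binomial
coefficient `l(l-1)⋯(l-i+1)/i!`. All sums are finite as soon as the modes satisfy the truncation
condition, which is part of the structures in which this identity is used. -/
def JacobiIdentity {V : Type u} [AddCommGroup V] [Module ℂ V] {M : Type v} [AddCommGroup M]
    [Module ℂ M] (Y : V →ₗ[ℂ] (ℤ → Module.End ℂ V)) (YM : V →ₗ[ℂ] (ℤ → Module.End ℂ M)) : Prop :=
  ∀ (a b : V) (l m n : ℤ) (c : M),
    (∑ᶠ i : ℕ, ((-1) ^ i * Ring.choose l i : ℤ) • YM a (l + m - i) (YM b (n + i) c))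
      - (∑ᶠ i : ℕ, ((Int.negOnePow l : ℤ) * ((-1) ^ i * Ring.choose l i) : ℤ) •
          YM b (l + n - i) (YM a (m + i) c))
    = ∑ᶠ i : ℕ, (Ring.choose m i : ℤ) • YM (Y a (l + i) b) (m + n - i) c

/-- A vertex algebra structure `(V, Y, 𝟏)` on a complex vector space `V`. -/
structure VertexAlgebra (V : Type u) [AddCommGroup V] [Module ℂ V] where
  /-- the linear map `v ↦ Y(v,z)`; `Y v n` is the mode `v_n` -/
  Y : V →ₗ[ℂ] (ℤ → Module.End ℂ V)
  /-- the vacuum vector -/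
  one : V
  trunc : ∀ a b : V, ∃ N : ℤ, ∀ n : ℤ, N ≤ n → Y a n b = 0
  vacuum : ∀ n : ℤ, Y one n = if n = -1 then LinearMap.id else 0
  creation_regular : ∀ (a : V) (n : ℤ), 0 ≤ n → Y a n one = 0
  creation : ∀ a : V, Y a (-1) one = a
  jacobi : JacobiIdentity Y Y

/-- A module structure on the complex vector space `M` over the vertex algebra `A` on `V`. -/
structure VertexModule {V : Type u} [AddCommGroup V] [Module ℂ V] (A : VertexAlgebra V)
    (M : Type v) [AddCommGroup M] [Module ℂ M] where
  /-- the linear map `v ↦ Y_M(v,z)`; `Y v n` is the mode `v_n` acting on `M` -/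
  Y : V →ₗ[ℂ] (ℤ → Module.End ℂ M)
  trunc : ∀ (a : V) (c : M), ∃ N : ℤ, ∀ n : ℤ, N ≤ n → Y a n c = 0
  vacuum : ∀ n : ℤ, Y A.one n = if n = -1 then LinearMap.id else 0
  jacobi : JacobiIdentity A.Y Y

/-! ### Auxiliary facts for transporting the Jacobi identity -/

theorem finsum_nat_eq_sum {M : Type v} [AddCommMonoid M] {f : ℕ → M} {K : ℕ}
    (h : ∀ i, K ≤ i → f i = 0) : ∑ᶠ i, f i = ∑ i ∈ Finset.range K, f i := by
  apply finsum_eq_sum_of_support_subset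
  intro i hi
  by_contra hK
  exact hi (h i (by simpa using hK))

section Aux

variable {V : Type u} [AddCommGroup V] [Module ℂ V] {M : Type v} [AddCommGroup M] [Module ℂ M]
  {N : Type w} [AddCommGroup N] [Module ℂ N]

/-- Under truncation, the three sums of the Jacobi identity are finite sums of any sufficiently
large length. -/
theorem jacobi_finite {Y : V →ₗ[ℂ] (ℤ → Module.End ℂ V)} {YM : V →ₗ[ℂ] (ℤ → Module.End ℂ M)}
    (hY : ∀ a b : V, ∃ N : ℤ, ∀ n : ℤ, N ≤ n → Y a n b = 0)
    (hM : ∀ (a : V) (c : M), ∃ N : ℤ, ∀ n : ℤ, N ≤ n → YM a n c = 0)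
    (a b : V) (l m n : ℤ) (c : M) :
    ∃ K₀ : ℕ, ∀ K, K₀ ≤ K →
      (∑ᶠ i : ℕ, ((-1) ^ i * Ring.choose l i : ℤ) • YM a (l + m - i) (YM b (n + i) c))
        = ∑ i ∈ Finset.range K,
          ((-1) ^ i * Ring.choose l i : ℤ) • YM a (l + m - i) (YM b (n + i) c) ∧
      (∑ᶠ i : ℕ, ((Int.negOnePow l : ℤ) * ((-1) ^ i * Ring.choose l i) : ℤ) •
          YM b (l + n - i) (YM a (m + i) c))
        = ∑ i ∈ Finset.range K, ((Int.negOnePow l : ℤ) * ((-1) ^ i * Ring.choose l i) : ℤ) •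
          YM b (l + n - i) (YM a (m + i) c) ∧
      (∑ᶠ i : ℕ, (Ring.choose m i : ℤ) • YM (Y a (l + i) b) (m + n - i) c)
        = ∑ i ∈ Finset.range K, (Ring.choose m i : ℤ) • YM (Y a (l + i) b) (m + n - i) c := by
  obtain ⟨N₁, h₁⟩ := hM b c
  obtain ⟨N₂, h₂⟩ := hM a c
  obtain ⟨N₃, h₃⟩ := hY a b
  refine ⟨(N₁ - n).toNat + (N₂ - m).toNat + (N₃ - l).toNat, fun K hK => ⟨?_, ?_, ?_⟩⟩
  · refine finsum_nat_eq_sum fun i hi => ?_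
    rw [h₁ (n + i) (by omega)]
    simp
  · refine finsum_nat_eq_sum fun i hi => ?_
    rw [h₂ (m + i) (by omega)]
    simp
  · refine finsum_nat_eq_sum fun i hi => ?_
    rw [h₃ (l + i) (by omega)]
    simp

/-- The Jacobi identity passes to a space that is separated by maps into a module. -/
theorem JacobiIdentity.of_separating {Y : V →ₗ[ℂ] (ℤ → Module.End ℂ V)} {ι : Type x}
    {YM : V →ₗ[ℂ] (ℤ → Module.End ℂ M)} {YN : V →ₗ[ℂ] (ℤ → Module.End ℂ N)}
    (φ : ι → N →ₗ[ℂ] M) (hφ : ∀ c, (∀ j, φ j c = 0) → c = 0)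
    (hcomm : ∀ j a n c, φ j (YN a n c) = YM a n (φ j c))
    (hY : ∀ a b : V, ∃ N : ℤ, ∀ n : ℤ, N ≤ n → Y a n b = 0)
    (hM : ∀ (a : V) (c : M), ∃ N : ℤ, ∀ n : ℤ, N ≤ n → YM a n c = 0)
    (hN : ∀ (a : V) (c : N), ∃ N : ℤ, ∀ n : ℤ, N ≤ n → YN a n c = 0)
    (h : JacobiIdentity Y YM) : JacobiIdentity Y YN := by
  intro a b l m n c
  rw [← sub_eq_zero]
  apply hφ
  intro j
  obtain ⟨K₁, hK₁⟩ := jacobi_finite hY hM a b l m n (φ j c)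
  obtain ⟨K₂, hK₂⟩ := jacobi_finite hY hN a b l m n c
  have e := h a b l m n (φ j c)
  obtain ⟨e₁, e₂, e₃⟩ := hK₁ (K₁ + K₂) (by omega)
  obtain ⟨f₁, f₂, f₃⟩ := hK₂ (K₁ + K₂) (by omega)
  rw [e₁, e₂, e₃, ← sub_eq_zero] at e
  rw [f₁, f₂, f₃]
  simpa only [map_sub, map_sum, map_zsmul, hcomm] using e

/-- The Jacobi identity passes to a space that is generated by images of modules. -/
theorem JacobiIdentity.of_spanning {Y : V →ₗ[ℂ] (ℤ → Module.End ℂ V)} {ι : Type x}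
    {P : ι → Type v} [∀ j, AddCommGroup (P j)] [∀ j, Module ℂ (P j)]
    {YP : ∀ j, V →ₗ[ℂ] (ℤ → Module.End ℂ (P j))} {YN : V →ₗ[ℂ] (ℤ → Module.End ℂ N)}
    (ψ : ∀ j, P j →ₗ[ℂ] N)
    (hψ : ∀ p : N → Prop, p 0 → (∀ j c, p (ψ j c)) → (∀ c d, p c → p d → p (c + d)) → ∀ c, p c)
    (hcomm : ∀ j a n c, ψ j (YP j a n c) = YN a n (ψ j c))
    (hY : ∀ a b : V, ∃ N : ℤ, ∀ n : ℤ, N ≤ n → Y a n b = 0)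
    (hP : ∀ j (a : V) (c : P j), ∃ N : ℤ, ∀ n : ℤ, N ≤ n → YP j a n c = 0)
    (hN : ∀ (a : V) (c : N), ∃ N : ℤ, ∀ n : ℤ, N ≤ n → YN a n c = 0)
    (h : ∀ j, JacobiIdentity Y (YP j)) : JacobiIdentity Y YN := by
  intro a b l m n
  refine hψ _ (by simp) ?_ ?_
  · intro j c
    obtain ⟨K₁, hK₁⟩ := jacobi_finite hY (hP j) a b l m n c
    obtain ⟨K₂, hK₂⟩ := jacobi_finite hY hN a b l m n (ψ j c)
    have e := h j a b l m n c
    obtain ⟨e₁, e₂, e₃⟩ := hK₁ (K₁ + K₂) (by omega)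
    obtain ⟨f₁, f₂, f₃⟩ := hK₂ (K₁ + K₂) (by omega)
    rw [e₁, e₂, e₃] at e
    rw [f₁, f₂, f₃]
    simpa only [map_sub, map_sum, map_zsmul, hcomm] using congrArg (ψ j) e
  · intro c d hc hd
    obtain ⟨K₁, hK₁⟩ := jacobi_finite hY hN a b l m n c
    obtain ⟨K₂, hK₂⟩ := jacobi_finite hY hN a b l m n d
    obtain ⟨K₃, hK₃⟩ := jacobi_finite hY hN a b l m n (c + d)
    obtain ⟨e₁, e₂, e₃⟩ := hK₁ (K₁ + K₂ + K₃) (by omega)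
    obtain ⟨f₁, f₂, f₃⟩ := hK₂ (K₁ + K₂ + K₃) (by omega)
    obtain ⟨g₁, g₂, g₃⟩ := hK₃ (K₁ + K₂ + K₃) (by omega)
    rw [e₁, e₂, e₃] at hc
    rw [f₁, f₂, f₃] at hd
    rw [g₁, g₂, g₃]
    simp only [map_add, smul_add, Finset.sum_add_distrib]
    rw [← hc, ← hd]
    abel

theorem trunc_of_spanning {ι : Type x}
    {P : ι → Type v} [∀ j, AddCommGroup (P j)] [∀ j, Module ℂ (P j)]
    {YP : ∀ j, V →ₗ[ℂ] (ℤ → Module.End ℂ (P j))} {YN : V →ₗ[ℂ] (ℤ → Module.End ℂ N)}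
    (ψ : ∀ j, P j →ₗ[ℂ] N)
    (hψ : ∀ p : N → Prop, p 0 → (∀ j c, p (ψ j c)) → (∀ c d, p c → p d → p (c + d)) → ∀ c, p c)
    (hcomm : ∀ j a n c, ψ j (YP j a n c) = YN a n (ψ j c))
    (hP : ∀ j (a : V) (c : P j), ∃ N : ℤ, ∀ n : ℤ, N ≤ n → YP j a n c = 0)
    (a : V) (c : N) : ∃ N : ℤ, ∀ n : ℤ, N ≤ n → YN a n c = 0 := by
  revert c
  refine hψ _ ⟨0, by simp⟩ ?_ ?_
  · intro j c
    obtain ⟨K, hK⟩ := hP j a c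
    exact ⟨K, fun n hn => by rw [← hcomm, hK n hn, map_zero]⟩
  · rintro c d ⟨K₁, h₁⟩ ⟨K₂, h₂⟩
    refine ⟨max K₁ K₂, fun n hn => ?_⟩
    rw [map_add, h₁ n (le_trans (le_max_left _ _) hn), h₂ n (le_trans (le_max_right _ _) hn),
      add_zero]

end Aux

/-! ### Constructions with modules -/

namespace VertexModule

variable {V : Type u} [AddCommGroup V] [Module ℂ V] {A : VertexAlgebra V}

/-- A subspace is a submodule if it is stable under all modes `v_n`. -/
def IsStable {M : Type v} [AddCommGroup M] [Module ℂ M] (X : VertexModule A M)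
    (N : Submodule ℂ M) : Prop :=
  ∀ (a : V) (n : ℤ), ∀ c ∈ N, X.Y a n c ∈ N

/-- The module structure on a stable subspace. -/
def submodule {M : Type v} [AddCommGroup M] [Module ℂ M] (X : VertexModule A M)
    (N : Submodule ℂ M) (hN : X.IsStable N) : VertexModule A N where
  Y :=
    { toFun := fun a n => (X.Y a n).restrict (hN a n)
      map_add' := by intros; ext; simp
      map_smul' := by intros; ext; simp }
  trunc a c := by
    obtain ⟨K, hK⟩ := X.trunc a c
    exact ⟨K, fun n hn => Subtype.ext (hK n hn)⟩
  vacuum n := by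
    ext c
    simp only [LinearMap.coe_mk, AddHom.coe_mk, LinearMap.restrict_apply, X.vacuum]
    split_ifs <;> rfl
  jacobi := by
    refine JacobiIdentity.of_separating (fun _ : Unit => N.subtype) (fun c h => ?_)
      (fun _ _ _ _ => rfl) A.trunc X.trunc (fun a c => ?_) X.jacobi
    · exact Subtype.ext (h ())
    · obtain ⟨K, hK⟩ := X.trunc a c
      exact ⟨K, fun n hn => Subtype.ext (hK n hn)⟩

/-- A module is irreducible if it is nonzero and has no submodules other than `0` and itself. -/
def IsIrreducible {M : Type v} [AddCommGroup M] [Module ℂ M] (X : VertexModule A M) : Prop :=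
  Nontrivial M ∧ ∀ N : Submodule ℂ M, X.IsStable N → N = ⊥ ∨ N = ⊤

/-- Two modules are isomorphic if there is a linear isomorphism intertwining all modes. -/
def IsIsomorphic {M : Type v} [AddCommGroup M] [Module ℂ M] (X : VertexModule A M)
    {M' : Type w} [AddCommGroup M'] [Module ℂ M'] (X' : VertexModule A M') : Prop :=
  ∃ e : M ≃ₗ[ℂ] M', ∀ (a : V) (n : ℤ) (c : M), e (X.Y a n c) = X'.Y a n (e c)

/-- A module is completely reducible if it is the direct sum of a set of irreducible
submodules. -/
def IsCompletelyReducible {M : Type v} [AddCommGroup M] [Module ℂ M]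
    (X : VertexModule A M) : Prop :=
  ∃ S : Set (Submodule ℂ M),
    (∀ N ∈ S, ∃ hN : X.IsStable N, (X.submodule N hN).IsIrreducible) ∧
      sSupIndep S ∧ sSup S = ⊤

/-- For a vector space `W` and a module `M`, the module `W ⊗ M` with `v_n (s ⊗ c) = s ⊗ v_n c`. -/
def tensor (W : Type w) [AddCommGroup W] [Module ℂ W] {M : Type v} [AddCommGroup M] [Module ℂ M]
    (X : VertexModule A M) : VertexModule A (W ⊗[ℂ] M) where
  Y :=
    { toFun := fun a n => (X.Y a n).lTensor W
      map_add' := by intros; ext; simp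
      map_smul' := by intros; ext; simp }
  trunc := by
    refine trunc_of_spanning (P := fun _ : W => M) (YP := fun _ => X.Y)
      (fun s => TensorProduct.mk ℂ W M s) (fun p h₀ h₁ h₂ c => ?_) (fun _ _ _ _ => rfl)
      (fun _ => X.trunc)
    exact TensorProduct.induction_on c h₀ h₁ h₂
  vacuum n := by
    ext s c
    simp only [LinearMap.coe_mk, AddHom.coe_mk, X.vacuum]
    split_ifs <;> simp
  jacobi := by
    refine JacobiIdentity.of_spanning (P := fun _ : W => M) (YP := fun _ => X.Y)
      (fun s => TensorProduct.mk ℂ W M s) (fun p h₀ h₁ h₂ c => ?_) (fun _ _ _ _ => rfl)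
      A.trunc (fun _ => X.trunc) ?_ (fun _ => X.jacobi)
    · exact TensorProduct.induction_on c h₀ h₁ h₂
    · refine trunc_of_spanning (P := fun _ : W => M) (YP := fun _ => X.Y)
        (fun s => TensorProduct.mk ℂ W M s) (fun p h₀ h₁ h₂ c => ?_) (fun _ _ _ _ => rfl)
        (fun _ => X.trunc)
      exact TensorProduct.induction_on c h₀ h₁ h₂

open Classical in
/-- The direct sum of a family of modules, with componentwise action. -/
def directSum {ι : Type w} {M : ι → Type v} [∀ i, AddCommGroup (M i)] [∀ i, Module ℂ (M i)]
    (X : ∀ i, VertexModule A (M i)) : VertexModule A (⨁ i, M i) where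
  Y :=
    { toFun := fun a n => DirectSum.lmap fun i => (X i).Y a n
      map_add' := by intros; ext; simp
      map_smul' := by intros; ext; simp }
  trunc := by
    refine trunc_of_spanning (P := M) (YP := fun i => (X i).Y)
      (fun i => DirectSum.lof ℂ ι M i) (fun p h₀ h₁ h₂ c => ?_) (fun _ _ _ _ => ?_)
      (fun i => (X i).trunc)
    · exact DirectSum.induction_on c h₀ h₁ h₂
    · simp
  vacuum n := by
    ext i c
    simp only [LinearMap.coe_mk, AddHom.coe_mk, (X _).vacuum]
    split_ifs <;> simp
  jacobi := by
    refine JacobiIdentity.of_spanning (P := M) (YP := fun i => (X i).Y)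
      (fun i => DirectSum.lof ℂ ι M i) (fun p h₀ h₁ h₂ c => ?_) (fun _ _ _ _ => ?_)
      A.trunc (fun i => (X i).trunc) ?_ (fun i => (X i).jacobi)
    · exact DirectSum.induction_on c h₀ h₁ h₂
    · simp
    · refine trunc_of_spanning (P := M) (YP := fun i => (X i).Y)
        (fun i => DirectSum.lof ℂ ι M i) (fun p h₀ h₁ h₂ c => ?_) (fun _ _ _ _ => ?_)
        (fun i => (X i).trunc)
      · exact DirectSum.induction_on c h₀ h₁ h₂
      · simp

theorem multiplicity_trunc {G : Type x} [Monoid G] {M : Type v} [AddCommGroup M] [Module ℂ M]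
    (X : VertexModule A M) (σ : Representation ℂ G M)
    {W : Type w} [AddCommGroup W] [Module ℂ W] [Module.Finite ℂ W] (ρ : Representation ℂ G W)
    (a : V) (f : Representation.IntertwiningMap ρ σ) :
    ∃ N : ℤ, ∀ n : ℤ, N ≤ n → ∀ s, X.Y a n (f s) = 0 := by
  obtain ⟨S, hS⟩ := Module.Finite.fg_top (R := ℂ) (M := W)
  choose K hK using fun s : W => X.trunc a (f s)
  refine ⟨∑ s ∈ S, |K s|, fun n hn s => ?_⟩
  have hle : (⊤ : Submodule ℂ W) ≤ LinearMap.ker (X.Y a n ∘ₗ f.toLinearMap) := by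
    rw [← hS, Submodule.span_le]
    intro t ht
    have h1 : |K t| ≤ ∑ s ∈ S, |K s| :=
      Finset.single_le_sum (f := fun s => |K s|) (fun _ _ => abs_nonneg _) ht
    exact hK t n (le_trans (le_abs_self _) (h1.trans hn))
  exact hle (Submodule.mem_top (x := s))

/-- If `G` acts on a module `M` by operators commuting with all modes, the modes act on
`Hom_G(W, M)` by `(v_n f)(s) = v_n (f s)`. -/
def multiplicityModes {G : Type x} [Monoid G] {M : Type v} [AddCommGroup M] [Module ℂ M]
    (X : VertexModule A M) (σ : Representation ℂ G M)
    (hσ : ∀ (g : G) (a : V) (n : ℤ) (c : M), σ g (X.Y a n c) = X.Y a n (σ g c))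
    {W : Type w} [AddCommGroup W] [Module ℂ W] (ρ : Representation ℂ G W) :
    V →ₗ[ℂ] (ℤ → Module.End ℂ (Representation.IntertwiningMap ρ σ)) where
  toFun a n :=
    { toFun := fun f =>
        { toLinearMap := X.Y a n ∘ₗ f.toLinearMap
          isIntertwining' := fun g => by
            ext s
            simp [hσ, f.isIntertwining] }
      map_add' := by intros; ext; simp
      map_smul' := by intros; ext; simp }
  map_add' := by intros; ext; simp
  map_smul' := by intros; ext; simp

@[simp]
theorem multiplicityModes_apply {G : Type x} [Monoid G] {M : Type v} [AddCommGroup M] [Module ℂ M]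
    (X : VertexModule A M) (σ : Representation ℂ G M)
    (hσ : ∀ (g : G) (a : V) (n : ℤ) (c : M), σ g (X.Y a n c) = X.Y a n (σ g c))
    {W : Type w} [AddCommGroup W] [Module ℂ W] (ρ : Representation ℂ G W)
    (a : V) (n : ℤ) (f : Representation.IntertwiningMap ρ σ) (s : W) :
    X.multiplicityModes σ hσ ρ a n f s = X.Y a n (f s) := rfl

/-- Evaluation at a vector of `W`, as a linear map on `Hom_G(W, M)`. -/
def evalAt {G : Type x} [Monoid G] {M : Type v} [AddCommGroup M] [Module ℂ M]
    (σ : Representation ℂ G M) {W : Type w} [AddCommGroup W] [Module ℂ W]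
    (ρ : Representation ℂ G W) (s : W) : Representation.IntertwiningMap ρ σ →ₗ[ℂ] M where
  toFun f := f s
  map_add' _ _ := rfl
  map_smul' _ _ := rfl

theorem multiplicityModes_trunc {G : Type x} [Monoid G] {M : Type v} [AddCommGroup M] [Module ℂ M]
    (X : VertexModule A M) (σ : Representation ℂ G M)
    (hσ : ∀ (g : G) (a : V) (n : ℤ) (c : M), σ g (X.Y a n c) = X.Y a n (σ g c))
    {W : Type w} [AddCommGroup W] [Module ℂ W] [Module.Finite ℂ W] (ρ : Representation ℂ G W)
    (a : V) (f : Representation.IntertwiningMap ρ σ) :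
    ∃ N : ℤ, ∀ n : ℤ, N ≤ n → X.multiplicityModes σ hσ ρ a n f = 0 := by
  obtain ⟨K, hK⟩ := X.multiplicity_trunc σ ρ a f
  refine ⟨K, fun n hn => ?_⟩
  ext s
  exact hK n hn s

/-- Let a group `G` act on a module `M` by operators commuting with all modes. For a
finite-dimensional representation `W` of `G`, the multiplicity space `Hom_G(W, M)` is a module
with `(v_n f)(s) = v_n (f s)`. -/
def multiplicity {G : Type x} [Monoid G] {M : Type v} [AddCommGroup M] [Module ℂ M]
    (X : VertexModule A M) (σ : Representation ℂ G M)
    (hσ : ∀ (g : G) (a : V) (n : ℤ) (c : M), σ g (X.Y a n c) = X.Y a n (σ g c))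
    {W : Type w} [AddCommGroup W] [Module ℂ W] [Module.Finite ℂ W] (ρ : Representation ℂ G W) :
    VertexModule A (Representation.IntertwiningMap ρ σ) where
  Y := X.multiplicityModes σ hσ ρ
  trunc := X.multiplicityModes_trunc σ hσ ρ
  vacuum n := by
    ext f s
    change X.Y A.one n (f s) = _
    rw [X.vacuum]
    split_ifs <;> rfl
  jacobi := by
    refine JacobiIdentity.of_separating (evalAt σ ρ) (fun f h => ?_) (fun _ _ _ _ => rfl)
      A.trunc X.trunc (X.multiplicityModes_trunc σ hσ ρ) X.jacobi
    ext s
    exact h s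

end VertexModule

/-! ### Simplicity, subalgebras, automorphisms -/

namespace VertexAlgebra

variable {V : Type u} [AddCommGroup V] [Module ℂ V]

/-- A vertex algebra as a module over itself. -/
def adjoint (A : VertexAlgebra V) : VertexModule A V where
  Y := A.Y
  trunc := A.trunc
  vacuum := A.vacuum
  jacobi := A.jacobi

/-- A vertex algebra is simple if it is irreducible as a module over itself. -/
def IsSimple (A : VertexAlgebra V) : Prop := A.adjoint.IsIrreducible

/-- A vertex subalgebra: a subspace containing the vacuum and closed under all products `a_n b`. -/
structure Subalgebra (A : VertexAlgebra V) where
  /-- the underlying subspace -/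
  carrier : Submodule ℂ V
  one_mem : A.one ∈ carrier
  mode_mem : ∀ (n : ℤ), ∀ a ∈ carrier, ∀ b ∈ carrier, A.Y a n b ∈ carrier

namespace Subalgebra

variable {A : VertexAlgebra V}

/-- The restriction of the vertex operators to a subalgebra. -/
def modes (U : A.Subalgebra) : U.carrier →ₗ[ℂ] (ℤ → Module.End ℂ U.carrier) where
  toFun a n := (A.Y a n).restrict (U.mode_mem n a a.2)
  map_add' := by intros; ext; simp
  map_smul' := by intros; ext; simp

theorem modes_trunc (U : A.Subalgebra) (a b : U.carrier) :
    ∃ N : ℤ, ∀ n : ℤ, N ≤ n → U.modes a n b = 0 := by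
  obtain ⟨K, hK⟩ := A.trunc a b
  exact ⟨K, fun n hn => Subtype.ext (hK n hn)⟩

/-- A subalgebra is a vertex algebra. -/
def toVertexAlgebra (U : A.Subalgebra) : VertexAlgebra U.carrier where
  Y := U.modes
  one := ⟨A.one, U.one_mem⟩
  trunc := U.modes_trunc
  vacuum n := by
    ext c
    simp only [modes, LinearMap.coe_mk, AddHom.coe_mk, LinearMap.restrict_apply, A.vacuum]
    split_ifs <;> rfl
  creation_regular a n hn := Subtype.ext (A.creation_regular a n hn)
  creation a := Subtype.ext (A.creation a)
  jacobi := by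
    refine JacobiIdentity.of_separating (YM := A.Y ∘ₗ U.carrier.subtype)
      (fun _ : Unit => U.carrier.subtype) (fun c h => Subtype.ext (h ()))
      (fun _ _ _ _ => rfl) U.modes_trunc (fun a c => A.trunc a c) U.modes_trunc ?_
    intro a b l m n c
    exact A.jacobi a b l m n c

end Subalgebra

/-- The restriction of a module to a vertex subalgebra. -/
def _root_.VertexModule.restrict {A : VertexAlgebra V} {M : Type v} [AddCommGroup M] [Module ℂ M]
    (X : VertexModule A M) (U : A.Subalgebra) : VertexModule U.toVertexAlgebra M where
  Y := X.Y ∘ₗ U.carrier.subtype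
  trunc a c := X.trunc a c
  vacuum n := X.vacuum n
  jacobi := by
    intro a b l m n c
    exact X.jacobi a b l m n c

/-- The group `Aut(V)` of automorphisms: invertible linear maps `g` with `g 𝟏 = 𝟏` and
`g Y(a,z) g⁻¹ = Y(g a,z)`. -/
def Aut (A : VertexAlgebra V) : Subgroup (V ≃ₗ[ℂ] V) where
  carrier := {g | g A.one = A.one ∧ ∀ (a : V) (n : ℤ) (b : V), g (A.Y a n b) = A.Y (g a) n (g b)}
  one_mem' := ⟨rfl, fun _ _ _ => rfl⟩
  mul_mem' := by
    rintro g h ⟨hg, hg'⟩ ⟨hh, hh'⟩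
    refine ⟨?_, fun a n b => ?_⟩
    · rw [LinearEquiv.mul_apply, hh, hg]
    · simp only [LinearEquiv.mul_apply, hh', hg']
  inv_mem' := by
    rintro g ⟨hg, hg'⟩
    have key : ∀ x, g (g⁻¹ x) = x := fun x => g.apply_symm_apply x
    refine ⟨?_, fun a n b => ?_⟩
    · apply g.injective
      rw [key, hg]
    · apply g.injective
      rw [key, hg', key, key]

variable (A : VertexAlgebra V) (G : Subgroup A.Aut)

/-- The natural representation on `V` of a group `G` of automorphisms. -/
def natRep : Representation ℂ G V where
  toFun g := (((g : A.Aut) : V ≃ₗ[ℂ] V) : V →ₗ[ℂ] V)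
  map_one' := rfl
  map_mul' _ _ := rfl

/-- The fixed points `V^G`, a vertex subalgebra of `V`. -/
def fixed : A.Subalgebra where
  carrier :=
    { carrier := {a | ∀ g : G, A.natRep G g a = a}
      add_mem' := fun {a b} ha hb g => by rw [map_add, ha g, hb g]
      zero_mem' := fun g => map_zero _
      smul_mem' := fun r a ha g => by rw [map_smul, ha g] }
  one_mem g := (g : A.Aut).2.1
  mode_mem n a ha b hb g := by
    have h := (g : A.Aut).2.2 a n b
    have ha' : ((g : A.Aut) : V ≃ₗ[ℂ] V) a = a := ha g
    have hb' : ((g : A.Aut) : V ≃ₗ[ℂ] V) b = b := hb g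
    rw [ha', hb'] at h
    exact h

/-- The orbifold vertex algebra `V^G`. -/
abbrev orbifold : VertexAlgebra (A.fixed G).carrier := (A.fixed G).toVertexAlgebra

/-- `V` as a `V^G`-module. -/
def overOrbifold : VertexModule (A.orbifold G) V := A.adjoint.restrict (A.fixed G)

/-- The actions of `G` and of `V^G` on `V` commute. -/
theorem natRep_comm (g : G) (a : (A.fixed G).carrier) (n : ℤ) (c : V) :
    A.natRep G g ((A.overOrbifold G).Y a n c) = (A.overOrbifold G).Y a n (A.natRep G g c) := by
  have h := (g : A.Aut).2.2 a n c
  have ha' : ((g : A.Aut) : V ≃ₗ[ℂ] V) a = a := a.2 g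
  rw [ha'] at h
  exact h

/-- The multiplicity space `Hom_G(W, V)` of a representation `W` of `G`, as a `V^G`-module with
`(v_n f)(s) = v_n (f s)`. -/
def multiplicityModule {W : Type w} [AddCommGroup W] [Module ℂ W] [Module.Finite ℂ W]
    (ρ : Representation ℂ G W) :
    VertexModule (A.orbifold G) (Representation.IntertwiningMap ρ (A.natRep G)) :=
  (A.overOrbifold G).multiplicity (A.natRep G) (A.natRep_comm G) ρ

end VertexAlgebra

/-! ### Irreducible characters and the isotypic decomposition -/

/-- The set of irreducible complex characters of a group `G`. -/
def irrCharacters (G : Type u) [Group G] : Set (G → ℂ) :=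
  {χ | ∃ (d : ℕ) (ρ : Representation ℂ G (Fin d → ℂ)), ρ.IsIrreducible ∧ ρ.character = χ}

open Classical in
/-- The natural map `⨁ W_i ⊗ Hom_G(W_i, M) → M`, `s ⊗ f ↦ f s`. -/
def evalMap {G : Type x} [Monoid G] {M : Type v} [AddCommGroup M] [Module ℂ M]
    (σ : Representation ℂ G M) {ι : Type u} {W : ι → Type w} [∀ i, AddCommGroup (W i)]
    [∀ i, Module ℂ (W i)] (ρ : ∀ i, Representation ℂ G (W i)) :
    (⨁ i, W i ⊗[ℂ] Representation.IntertwiningMap (ρ i) σ) →ₗ[ℂ] M :=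
  DirectSum.toModule ℂ ι M fun i =>
    TensorProduct.lift
      (LinearMap.flip
        { toFun := fun f : Representation.IntertwiningMap (ρ i) σ => f.toLinearMap
          map_add' := fun _ _ => rfl
          map_smul' := fun _ _ => rfl })

end

/-! The proof rests on a density statement for the linear span of the single modes, not merely for
the algebra they generate. Suitable indices in the Jacobi identity show that, on a given vector, a
product of two modes agrees with a linear combination of modes. Applied to finite powers of a
module, this replaces any element of the mode algebra by one combination of modes on finitely many
vectors. Countable dimension over the uncountable field ℂ gives Schur's lemma, and Jacobson density
then yields `IsIrreducible.exists_modeSpan_eq`: on finitely many vectors of `V`, every linear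
operator agrees with a combination of modes.

Single modes matter because conjugation by an automorphism turns `a_n` into `(g a)_n`, which is
linear in `a`. This has two consequences.

A relation `∑ φ(g) g = 0` implies `∑ φ(g) g T g⁻¹ = 0` for every combination `T` of modes. Letting
`T` imitate rank-one operators, one may multiply `φ` by matrix coefficients of `V`, which separate
the elements of `G`; hence the automorphisms are linearly independent
(`functionOp_natRep_injective`). If an irreducible representation did not occur in `V`, its matrix
coefficients would be relations, so every irreducible representation occurs.

Averaging `g T g⁻¹` over `G` gives combinations of modes of `V^G`, so on finitely many vectors these
realize any operator that behaves equivariantly there (`exists_modeSpan_overOrbifold_eq`). They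
carry any nonzero `f` in a multiplicity space to any other element, and they separate multiplicity
spaces of different characters.

The decomposition of `V` itself is finite group theory: semisimplicity gives surjectivity of the
evaluation map, and matrix units built from Schur orthogonality give injectivity. -/

noncomputable section

universe u v w x

/-! ### Products of modes and the submodule generated by a vector. -/

namespace VertexModule

variable {V : Type u} [AddCommGroup V] [Module ℂ V] {A : VertexAlgebra V}
  {M : Type v} [AddCommGroup M] [Module ℂ M]

/-- The linear span of all modes `v_n` acting on a module. -/
def modeSpan (X : VertexModule A M) : Submodule ℂ (Module.End ℂ M) :=
  Submodule.span ℂ (Set.range fun p : V × ℤ => X.Y p.1 p.2)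

theorem mode_mem_modeSpan (X : VertexModule A M) (a : V) (n : ℤ) : X.Y a n ∈ X.modeSpan :=
  Submodule.subset_span ⟨(a, n), rfl⟩

/-- The vectors `T c`, where `T` runs through the span of the modes. -/
def modeOrbit (X : VertexModule A M) (c : M) : Submodule ℂ M :=
  X.modeSpan.map (LinearMap.applyₗ c)

theorem mode_mem_modeOrbit (X : VertexModule A M) (a : V) (n : ℤ) (c : M) :
    X.Y a n c ∈ X.modeOrbit c := ⟨_, X.mode_mem_modeSpan a n, rfl⟩

theorem self_mem_modeOrbit (X : VertexModule A M) (c : M) : c ∈ X.modeOrbit c := by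
  have h := X.mode_mem_modeOrbit A.one (-1) c
  rwa [X.vacuum, if_pos rfl] at h

/-- A product of two modes agrees on a given vector with a combination of modes. -/
theorem mode_mode_mem_modeOrbit (X : VertexModule A M) (a b : V) (p q : ℤ) (c : M) :
    X.Y a p (X.Y b q c) ∈ X.modeOrbit c := by
  obtain ⟨m, hm⟩ := X.trunc a c
  obtain ⟨K, hK⟩ := X.trunc b c
  -- Induction on how far `q` lies below the bound `K` beyond which the modes of `b` kill `c`.
  suffices H : ∀ (k : ℕ) (p q : ℤ), K ≤ q + k → X.Y a p (X.Y b q c) ∈ X.modeOrbit c from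
    H (K - q).toNat p q (by omega)
  intro k
  induction k using Nat.strong_induction_on with
  | _ k ih =>
    intro p q hq
    -- With indices `(p - m, m, q)` every term of the second sum contains `a_(m+i) c = 0`. The term
    -- `i = 0` of the first sum is `a_p b_q c`; the others involve `a_(p-i) b_(q+i) c` with a larger
    -- index on `b`, and the right-hand side consists of single modes.
    obtain ⟨K₀, hK₀⟩ := jacobi_finite A.trunc X.trunc a b (p - m) m q c
    obtain ⟨e₁, e₂, e₃⟩ := hK₀ (K₀ + 1) (by omega)
    have e := X.jacobi a b (p - m) m q c
    rw [e₁, e₂, e₃, Finset.sum_range_succ'] at e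
    have z : ∑ i ∈ Finset.range (K₀ + 1),
        ((Int.negOnePow (p - m) : ℤ) * ((-1) ^ i * Ring.choose (p - m) i) : ℤ) •
          X.Y b (p - m + q - i) (X.Y a (m + i) c) = 0 :=
      Finset.sum_eq_zero fun i _ => by rw [hm _ (by omega), map_zero, smul_zero]
    rw [z, sub_zero] at e
    simp only [Nat.cast_zero, pow_zero, Ring.choose_zero_right, mul_one, one_smul, sub_zero,
      add_zero, sub_add_cancel] at e
    rw [← eq_sub_iff_add_eq'] at e
    rw [e]
    refine Submodule.sub_mem _ (Submodule.sum_mem _ fun i _ => ?_)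
      (Submodule.sum_mem _ fun i _ => ?_)
    · exact zsmul_mem (X.mode_mem_modeOrbit _ _ _) _
    · refine zsmul_mem ?_ _
      rcases Nat.eq_zero_or_pos k with hk | hk
      · rw [hK _ (by push_cast; omega), map_zero]
        exact zero_mem _
      · exact ih (k - 1) (by omega) _ _ (by push_cast; omega)

theorem isStable_modeOrbit (X : VertexModule A M) (c : M) : X.IsStable (X.modeOrbit c) := by
  rintro a n _ ⟨T, hT, rfl⟩
  change X.Y a n (T c) ∈ _
  induction hT using Submodule.span_induction with
  | mem T hT =>
    obtain ⟨⟨b, q⟩, rfl⟩ := hT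
    exact X.mode_mode_mem_modeOrbit a b n q c
  | zero => simp
  | add S T _ _ hS hT => simpa using add_mem hS hT
  | smul r T _ hT => simpa using Submodule.smul_mem _ r hT

/-! ### Combinations of modes acting on several vectors at once. -/

/-- A finite power of a module. -/
def pi (ι : Type x) [Finite ι] (X : VertexModule A M) : VertexModule A (ι → M) :=
  have trunc : ∀ (a : V) (c : ι → M), ∃ N : ℤ, ∀ n : ℤ, N ≤ n →
      (X.Y a n).compLeft ι c = 0 := fun a c => by
    choose K hK using fun i => X.trunc a (c i)
    obtain ⟨N, hN⟩ := Finite.bddAbove_range K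
    exact ⟨N, fun n hn => funext fun i => hK i n ((hN ⟨i, rfl⟩).trans hn)⟩
  { Y :=
      { toFun := fun a n => (X.Y a n).compLeft ι
        map_add' := by intros; ext; simp
        map_smul' := by intros; ext; simp }
    trunc := trunc
    vacuum := fun n => by
      ext c i
      simp only [LinearMap.coe_mk, AddHom.coe_mk, X.vacuum]
      split_ifs <;> rfl
    jacobi := JacobiIdentity.of_separating (fun i => LinearMap.proj i)
      (fun _ h => funext h) (fun _ _ _ _ => rfl) A.trunc X.trunc trunc X.jacobi }

theorem exists_of_mem_modeSpan_pi {ι : Type x} [Finite ι] (X : VertexModule A M)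
    {T : Module.End ℂ (ι → M)} (hT : T ∈ (X.pi ι).modeSpan) :
    ∃ S ∈ X.modeSpan, ∀ c i, T c i = S (c i) := by
  induction hT using Submodule.span_induction with
  | mem T hT =>
    obtain ⟨⟨b, q⟩, rfl⟩ := hT
    exact ⟨_, X.mode_mem_modeSpan b q, fun _ _ => rfl⟩
  | zero => exact ⟨0, zero_mem _, fun _ _ => rfl⟩
  | add S T _ _ hS hT =>
    obtain ⟨S', hS', hS⟩ := hS
    obtain ⟨T', hT', hT⟩ := hT
    exact ⟨S' + T', add_mem hS' hT', fun c i => by simp [hS, hT]⟩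
  | smul r T _ hT =>
    obtain ⟨T', hT', hT⟩ := hT
    exact ⟨r • T', Submodule.smul_mem _ r hT', fun c i => by simp [hT]⟩

/-- The associative algebra generated by all modes. -/
def modeAlgebra (X : VertexModule A M) : Subalgebra ℂ (Module.End ℂ M) :=
  Algebra.adjoin ℂ (Set.range fun p : V × ℤ => X.Y p.1 p.2)

/-- On finitely many vectors, every element of the algebra generated by the modes agrees with
a linear combination of modes. -/
theorem exists_modeSpan_eq_of_mem_modeAlgebra {ι : Type x} [Finite ι] (X : VertexModule A M)
    {T : Module.End ℂ M} (hT : T ∈ X.modeAlgebra) (c : ι → M) :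
    ∃ S ∈ X.modeSpan, ∀ i, S (c i) = T (c i) := by
  -- The family `c` is one vector of the power module. Its mode orbit is stable and contains `c`,
  -- hence contains `T c`; the modes act diagonally, so one combination serves all indices.
  have key : ∀ d ∈ (X.pi ι).modeOrbit c, (fun i => T (d i)) ∈ (X.pi ι).modeOrbit c := by
    induction hT using Algebra.adjoin_induction with
    | mem T hT =>
      obtain ⟨⟨b, q⟩, rfl⟩ := hT
      exact fun d hd => (X.pi ι).isStable_modeOrbit c b q d hd
    | algebraMap r =>
      exact fun d hd => Submodule.smul_mem _ r hd
    | add S T _ _ hS hT => exact fun d hd => add_mem (hS d hd) (hT d hd)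
    | mul S T _ _ hS hT => exact fun d hd => hS _ (hT d hd)
  obtain ⟨S, hS, h⟩ := key c ((X.pi ι).self_mem_modeOrbit c)
  obtain ⟨S', hS', h'⟩ := X.exists_of_mem_modeSpan_pi hS
  exact ⟨S', hS', fun i => (h' c i).symm.trans (congrFun h i)⟩

theorem isSimpleModule_modeAlgebra (X : VertexModule A M) (hX : X.IsIrreducible) :
    IsSimpleModule X.modeAlgebra M := by
  rw [isSimpleModule_iff]
  have := hX.1
  refine { eq_bot_or_eq_top := fun N => ?_ }
  have hN : X.IsStable (N.restrictScalars ℂ) := fun a n c hc =>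
    N.smul_mem (⟨X.Y a n, Algebra.subset_adjoin ⟨(a, n), rfl⟩⟩ : X.modeAlgebra) hc
  rcases hX.2 _ hN with h | h
  · exact Or.inl ((Submodule.restrictScalars_eq_bot_iff _ _ _).1 h)
  · exact Or.inr ((Submodule.restrictScalars_eq_top_iff _ _ _).1 h)

end VertexModule

/-! ### Schur's lemma and Jacobson density in countable dimension. -/

section Schur

variable {R : Type u} [Ring R] [Algebra ℂ R] {M : Type v} [AddCommGroup M] [Module ℂ M]
  [Module R M] [IsScalarTower ℂ R M] [IsSimpleModule R M]

open Polynomial in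
/-- An endomorphism of a simple module that is transcendental over the base field forces the
dimension to be uncountable. -/
theorem aleph0_lt_rank_of_transcendental_end {φ : Module.End R M} (hφ : Transcendental ℂ φ) :
    Cardinal.aleph0 < Module.rank ℂ M := by
  classical
  have hbij : ∀ p : ℂ[X], p ≠ 0 → Function.Bijective (aeval φ p) := fun p hp =>
    (LinearMap.bijective_or_eq_zero _).resolve_right fun h => hφ ⟨p, hp, h⟩
  have := IsSimpleModule.nontrivial R M
  obtain ⟨v, hv⟩ := exists_ne (0 : M)
  -- The vectors `y a = (φ - a)⁻¹ v`, one for each complex number, will be linearly independent: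
  -- continuum many.
  choose y hy using fun a : ℂ => (hbij (X - C a) (X_sub_C_ne_zero a)).2 v
  have hli : LinearIndependent ℂ y := by
    refine linearIndependent_iff'.2 fun s m hm i hi => ?_
    have h1 : ∀ j ∈ s, aeval φ (∏ k ∈ s, (X - C k)) (y j) =
        aeval φ (∏ k ∈ s.erase j, (X - C k)) v := fun j hj => by
      rw [← hy j, ← Module.End.mul_apply, ← map_mul, Finset.prod_erase_mul _ _ hj]
    -- Clearing denominators in the relation gives a polynomial in `φ` killing `v`. Its value at `i`
    -- is `m i * ∏ (i - k)`, so it is nonzero if `m i ≠ 0`, contradicting injectivity.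
    have h2 : aeval φ (∑ j ∈ s, C (m j) * ∏ k ∈ s.erase j, (X - C k)) v = 0 := by
      have := congrArg (aeval φ (∏ k ∈ s, (X - C k))) hm
      rw [map_zero, map_sum] at this
      rw [map_sum, LinearMap.sum_apply, ← this]
      refine Finset.sum_congr rfl fun j hj => ?_
      rw [C_mul', map_smul, LinearMap.smul_apply, LinearMap.map_smul_of_tower, h1 j hj]
    by_contra hmi
    have hp : (∑ j ∈ s, C (m j) * ∏ k ∈ s.erase j, (X - C k)) ≠ 0 := fun h => by
      have := congrArg (eval i) h
      rw [eval_finsetSum, Finset.sum_eq_single_of_mem i hi] at this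
      · simp only [eval_mul, eval_C, eval_prod, eval_sub, eval_X, eval_zero, mul_eq_zero, hmi,
          false_or, Finset.prod_eq_zero_iff, sub_eq_zero] at this
        obtain ⟨k, hk, rfl⟩ := this
        simp at hk
      · intro j _ hj
        rw [eval_mul, eval_prod, Finset.prod_eq_zero (Finset.mem_erase.2 ⟨hj.symm, hi⟩)] <;> simp
    exact hv ((hbij _ hp).1 (h2.trans (map_zero _).symm))
  have h := hli.cardinal_lift_le_rank
  rw [Cardinal.mk_complex, Cardinal.lift_continuum] at h
  have h' := Cardinal.aleph0_lt_continuum.trans_le h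
  exact Cardinal.lift_lt.{v, 0}.1 (by simpa using h')

/-- Schur's lemma for simple modules of countable dimension. -/
theorem exists_eq_algebraMap_end_of_rank_le_aleph0 (h : Module.rank ℂ M ≤ Cardinal.aleph0)
    (φ : Module.End R M) : ∃ z : ℂ, algebraMap ℂ (Module.End R M) z = φ := by
  classical
  -- No endomorphism is transcendental, so the division algebra `Module.End R M` is integral over an
  -- algebraically closed field and equals it.
  have : Algebra.IsIntegral ℂ (Module.End R M) :=
    ⟨fun ψ => (not_not.1 fun hψ => (aleph0_lt_rank_of_transcendental_end (φ := ψ) hψ).not_ge h :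
      IsAlgebraic ℂ ψ).isIntegral⟩
  exact (IsAlgClosed.algebraMap_bijective_of_isIntegral (k := ℂ) (K := Module.End R M)).2 φ

/-- The endomorphism ring consists of scalars, so every ℂ-linear map is linear over it and Jacobson
density applies. -/
theorem exists_smul_eq_of_rank_le_aleph0 (h : Module.rank ℂ M ≤ Cardinal.aleph0)
    (φ : Module.End ℂ M) (s : Finset M) : ∃ r : R, ∀ m ∈ s, φ m = r • m :=
  jacobson_density
    { toFun := φ
      map_add' := map_add φ
      map_smul' := fun ψ m => by
        obtain ⟨z, rfl⟩ := exists_eq_algebraMap_end_of_rank_le_aleph0 h ψ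
        exact map_smul φ z m } s

end Schur

/-! ### Density of the span of the modes. -/

namespace VertexModule

/-- The span of the modes acts densely on an irreducible module of countable dimension. -/
theorem IsIrreducible.exists_modeSpan_eq {V : Type u} [AddCommGroup V] [Module ℂ V]
    {A : VertexAlgebra V} {M : Type v} [AddCommGroup M] [Module ℂ M] {X : VertexModule A M}
    (hX : X.IsIrreducible) (h : Module.rank ℂ M ≤ Cardinal.aleph0) (φ : Module.End ℂ M)
    {ι : Type x} [Finite ι] (c : ι → M) : ∃ S ∈ X.modeSpan, ∀ i, S (c i) = φ (c i) := by
  have := X.isSimpleModule_modeAlgebra hX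
  obtain ⟨r, hr⟩ := exists_smul_eq_of_rank_le_aleph0 (R := X.modeAlgebra) h φ
    (Set.finite_range c).toFinset
  obtain ⟨S, hS, h⟩ := X.exists_modeSpan_eq_of_mem_modeAlgebra r.2 c
  exact ⟨S, hS, fun i => (h i).trans (hr (c i) (by simp)).symm⟩

end VertexModule

namespace Representation

variable {G : Type x} [Group G] {M : Type v} [AddCommGroup M] [Module ℂ M]
  {W : Type w} [AddCommGroup W] [Module ℂ W] {W' : Type u} [AddCommGroup W'] [Module ℂ W']

/-! ### Irreducible representations and characters -/

theorem IsIrreducible.of_equiv {ρ : Representation ℂ G W} {σ : Representation ℂ G M}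
    (hρ : ρ.IsIrreducible) (e : ρ.Equiv σ) : σ.IsIrreducible := by
  rw [irreducible_iff_isSimpleModule_asModule] at hρ ⊢
  exact IsSimpleModule.congr (LinearEquiv.ofBijective
    (IntertwiningMap.equivLinearMapAsModule ρ σ e.toIntertwiningMap) e.bijective).symm

/-- A basis transports the representation to coordinate space, where `irrCharacters` is defined. -/
theorem character_mem_irrCharacters {ρ : Representation ℂ G W} [Module.Finite ℂ W]
    (hρ : ρ.IsIrreducible) : ρ.character ∈ irrCharacters G := by
  let b := (Module.finBasis ℂ W).equivFun
  let ρ' : Representation ℂ G (Fin (Module.finrank ℂ W) → ℂ) := (b.conjRingEquiv : _ →* _).comp ρ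
  let e : ρ.Equiv ρ' := Equiv.mk b fun g => by
    ext v
    simp [ρ', LinearEquiv.conjRingEquiv]
  exact ⟨_, ρ', hρ.of_equiv e, (char_iso e).symm⟩

/-- Orthonormality of irreducible characters: the same inner product would be both 1 and 0 if the
representations were inequivalent. -/
theorem nonempty_equiv_of_character_eq [Finite G] {ρ : Representation ℂ G W}
    {σ : Representation ℂ G W'} [Module.Finite ℂ W] [Module.Finite ℂ W'] (hρ : ρ.IsIrreducible)
    (hσ : σ.IsIrreducible) (h : ρ.character = σ.character) : Nonempty (σ.Equiv ρ) := by
  classical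
  have := Fintype.ofFinite G
  have : Invertible (Nat.card G : ℂ) := invertibleOfNonzero (by simp)
  have h1 := char_orthonormal ρ ρ
  rw [if_pos ⟨Equiv.refl ρ⟩] at h1
  have h2 := char_orthonormal ρ σ
  rw [← h, h1] at h2
  by_contra hne
  rw [if_neg hne] at h2
  exact one_ne_zero h2

/-- The representation on a simple submodule over the group algebra is irreducible. -/
theorem isIrreducible_ofSubmodule' {σ : Representation ℂ G M}
    (N : Submodule (MonoidAlgebra ℂ G) σ.asModule) [IsSimpleModule (MonoidAlgebra ℂ G) N] :
    (Subrepresentation.ofSubmodule' N).toRepresentation.IsIrreducible := by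
  set P := Subrepresentation.ofSubmodule' N
  have hN : IsAtom N := isSimpleModule_iff_isAtom.1 inferInstance
  have hP : ∀ c : M, c ∈ P.toSubmodule ↔ c ∈ N := fun c => Iff.rfl
  have : Nontrivial (Subrepresentation P.toRepresentation) := by
    refine ⟨⊥, ⊤, fun h => hN.1 ((Submodule.eq_bot_iff _).2 fun c hc => ?_)⟩
    have h1 : (⟨c, hc⟩ : P.toSubmodule) ∈ (⊤ : Subrepresentation P.toRepresentation) :=
      Submodule.mem_top
    rw [← h] at h1
    exact congrArg Subtype.val ((Submodule.mem_bot ℂ).1 h1)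
  refine { eq_bot_or_eq_top := fun Q => ?_ }
  -- A subrepresentation of `P`, viewed inside `M`, is a group algebra submodule below the atom `N`.
  let Q' : Subrepresentation σ :=
    { toSubmodule := Q.toSubmodule.map P.toSubmodule.subtype
      apply_mem_toSubmodule := by
        rintro g _ ⟨c, hc, rfl⟩
        exact ⟨_, Q.apply_mem_toSubmodule g hc, rfl⟩ }
  have hQ : ∀ c : P.toSubmodule, (c : M) ∈ Q'.asSubmodule ↔ c ∈ Q.toSubmodule := fun c =>
    ⟨fun ⟨d, hd, h⟩ => by rwa [← Subtype.ext h], fun hc => ⟨c, hc, rfl⟩⟩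
  have hle : Q'.asSubmodule ≤ N := by
    rintro _ ⟨c, _, rfl⟩
    exact c.2
  rcases hN.le_iff.1 hle with h | h
  · left
    apply Subrepresentation.toSubmodule_injective
    refine (Submodule.eq_bot_iff _).2 fun c hc => Subtype.ext ?_
    have h1 := (hQ c).2 hc
    rw [h] at h1
    exact (Submodule.mem_bot (M := σ.asModule) (MonoidAlgebra ℂ G)).1 h1
  · right
    apply Subrepresentation.toSubmodule_injective
    refine (Submodule.eq_top_iff').2 fun c => (hQ c).1 ?_
    rw [h]
    exact c.2

/-- A simple module is finitely generated over the group algebra, which is finite-dimensional. -/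
theorem finite_ofSubmodule' [Finite G] {σ : Representation ℂ G M}
    (N : Submodule (MonoidAlgebra ℂ G) σ.asModule) [IsSimpleModule (MonoidAlgebra ℂ G) N] :
    Module.Finite ℂ (Subrepresentation.ofSubmodule' N).toSubmodule :=
  (Module.Finite.trans (MonoidAlgebra ℂ G) N : Module.Finite ℂ N)

/-- A representation of a finite group is spanned by the images of its irreducible
constituents. -/
theorem eq_top_of_forall_apply_mem [Finite G] (σ : Representation ℂ G M)
    {W : irrCharacters G → Type w} [∀ χ, AddCommGroup (W χ)] [∀ χ, Module ℂ (W χ)]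
    [∀ χ, Module.Finite ℂ (W χ)] {ρ : ∀ χ, Representation ℂ G (W χ)}
    (hirr : ∀ χ, (ρ χ).IsIrreducible) (hchar : ∀ χ, (ρ χ).character = (χ : G → ℂ))
    {N : Submodule ℂ M} (hN : ∀ χ (f : IntertwiningMap (ρ χ) σ) s, f s ∈ N) : N = ⊤ := by
  refine (Submodule.eq_top_iff').2 fun c => ?_
  have hc : (show σ.asModule from c) ∈ (⊤ : Submodule (MonoidAlgebra ℂ G) σ.asModule) :=
    Submodule.mem_top
  -- By Maschke's theorem it suffices to treat vectors of simple submodules, each equivalent to the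
  -- `W χ` with its character.
  rw [← IsSemisimpleModule.sSup_simples_eq_top, sSup_eq_iSup'] at hc
  refine Submodule.iSup_induction (M := σ.asModule) _
    (motive := fun c => (show M from c) ∈ N) hc ?_ N.zero_mem fun _ _ => N.add_mem
  rintro ⟨S, hS⟩ d hd
  have : IsSimpleModule (MonoidAlgebra ℂ G) S := hS
  set P := Subrepresentation.ofSubmodule' S
  have hP := isIrreducible_ofSubmodule' S
  have := finite_ofSubmodule' S
  let χ : irrCharacters G := ⟨_, character_mem_irrCharacters hP⟩
  obtain ⟨e⟩ := nonempty_equiv_of_character_eq hP (hirr χ) (hchar χ).symm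
  let i : IntertwiningMap P.toRepresentation σ := ⟨P.toSubmodule.subtype, fun g => rfl⟩
  have h := hN χ (i.comp e.toIntertwiningMap) (e.symm ⟨d, hd⟩)
  have h2 : (i.comp e.toIntertwiningMap) (e.symm ⟨d, hd⟩) = d :=
    congrArg i (e.apply_symm_apply ⟨d, hd⟩)
  rwa [h2] at h

/-! ### Matrix units in the group algebra -/

variable [Fintype G]

/-- The operator `∑ φ(g) g` attached to a function on the group. -/
def functionOp (σ : Representation ℂ G M) : (G → ℂ) →ₗ[ℂ] Module.End ℂ M :=
  Fintype.linearCombination ℂ (fun g => σ g)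

theorem functionOp_apply (σ : Representation ℂ G M) (φ : G → ℂ) (c : M) :
    functionOp σ φ c = ∑ g, φ g • σ g c := by
  simp [functionOp, Fintype.linearCombination_apply]

theorem IntertwiningMap.map_functionOp {ρ : Representation ℂ G W} {σ : Representation ℂ G M}
    (f : IntertwiningMap ρ σ) (φ : G → ℂ) (s : W) :
    f (functionOp ρ φ s) = functionOp σ φ (f s) := by
  rw [functionOp_apply, functionOp_apply, ← f.toLinearMap_apply, map_sum]
  simp [f.isIntertwining]

/-- The matrix coefficient `g ↦ ξ(g⁻¹ s)`. -/
def matrixCoeff (ρ : Representation ℂ G W) (ξ : Module.Dual ℂ W) (s : W) (g : G) : ℂ :=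
  ξ (ρ g⁻¹ s)

/-- The intertwining map `∑ g T g⁻¹`. -/
def sumConj (ρ : Representation ℂ G W) (σ : Representation ℂ G M) (T : W →ₗ[ℂ] M) :
    IntertwiningMap ρ σ where
  toLinearMap := ∑ g, σ g ∘ₗ T ∘ₗ ρ g⁻¹
  isIntertwining' h := by
    ext s
    simp only [LinearMap.comp_apply, LinearMap.sum_apply, map_sum]
    refine (Fintype.sum_equiv (_root_.Equiv.mulLeft h) _ _ fun g => ?_).symm
    simp [← Module.End.mul_apply, ← map_mul, mul_assoc]

theorem sumConj_apply (ρ : Representation ℂ G W) (σ : Representation ℂ G M) (T : W →ₗ[ℂ] M)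
    (s : W) : sumConj ρ σ T s = ∑ g, σ g (T (ρ g⁻¹ s)) := by
  change (∑ g, σ g ∘ₗ T ∘ₗ ρ g⁻¹) s = _
  simp

/-- Rewriting the operator as the average of a rank-one map, up to the factor `|G|`, produces an
intertwiner to which Schur's lemma applies. -/
theorem functionOp_matrixCoeff (ρ : Representation ℂ G W) (σ : Representation ℂ G M)
    (ξ : Module.Dual ℂ W) (s : W) (c : M) :
    functionOp σ (matrixCoeff ρ ξ s) c = sumConj ρ σ (ξ.smulRight c) s := by
  simp [functionOp_apply, sumConj_apply, matrixCoeff]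

theorem functionOp_matrixCoeff_of_isEmpty_equiv {ρ : Representation ℂ G W}
    {σ : Representation ℂ G W'} (hρ : ρ.IsIrreducible) (hσ : σ.IsIrreducible)
    [IsEmpty (ρ.Equiv σ)] (ξ : Module.Dual ℂ W) (s : W) :
    functionOp σ (matrixCoeff ρ ξ s) = 0 := by
  ext c
  rw [functionOp_matrixCoeff, Subsingleton.elim (sumConj ρ σ _) 0]
  rfl

theorem finrank_smul_functionOp_matrixCoeff_self {ρ : Representation ℂ G W} [Module.Finite ℂ W]
    (hρ : ρ.IsIrreducible) (ξ : Module.Dual ℂ W) (s t : W) :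
    (Module.finrank ℂ W : ℂ) • functionOp ρ (matrixCoeff ρ ξ s) t =
      ((Fintype.card G : ℂ) * ξ t) • s := by
  rw [functionOp_matrixCoeff]
  obtain ⟨z, hz⟩ := (IsIrreducible.algebraMap_intertwiningMap_bijective_of_isAlgClosed
    (ρ := ρ)).2 (sumConj ρ ρ (ξ.smulRight t))
  have h1 : (sumConj ρ ρ (ξ.smulRight t)).toLinearMap = z • LinearMap.id := by
    rw [← hz]
    rfl
  -- The trace determines the scalar `z`: each of the `|G|` conjugates of the rank-one map has trace
  -- `ξ t`.
  have h2 : LinearMap.trace ℂ W (sumConj ρ ρ (ξ.smulRight t)).toLinearMap =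
      Fintype.card G * ξ t := by
    change LinearMap.trace ℂ W (∑ g, ρ g ∘ₗ ξ.smulRight t ∘ₗ ρ g⁻¹) = _
    rw [map_sum, Finset.sum_congr rfl fun g _ => ?_, Finset.sum_const, Finset.card_univ,
      nsmul_eq_mul]
    rw [← LinearMap.trace_smulRight ξ t,
      ← Module.End.mul_eq_comp, LinearMap.trace_mul_comm, ← Module.End.mul_eq_comp, mul_assoc,
      ← map_mul, inv_mul_cancel, map_one, mul_one]
  rw [← IntertwiningMap.toLinearMap_apply, ← h2, h1]
  simp [mul_smul, smul_comm z]

/-- For an irreducible representation `W`, the operator on a representation by which the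
`W`-isotypic part is mapped as by `t ↦ ξ(t) s` on `W`. -/
def matrixUnit (ρ : Representation ℂ G W) (σ : Representation ℂ G M) (ξ : Module.Dual ℂ W)
    (s : W) : Module.End ℂ M :=
  ((Module.finrank ℂ W : ℂ) / Fintype.card G) • functionOp σ (matrixCoeff ρ ξ s)

theorem matrixUnit_apply_self {ρ : Representation ℂ G W} [Module.Finite ℂ W]
    (hρ : ρ.IsIrreducible) {σ : Representation ℂ G M} (f : IntertwiningMap ρ σ)
    (ξ : Module.Dual ℂ W) (s t : W) : matrixUnit ρ σ ξ s (f t) = ξ t • f s := by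
  have hG : (Fintype.card G : ℂ) ≠ 0 := by simp
  rw [matrixUnit, LinearMap.smul_apply, ← f.map_functionOp, div_eq_inv_mul, mul_smul,
    ← f.toLinearMap_apply, ← map_smul, finrank_smul_functionOp_matrixCoeff_self hρ, map_smul,
    ← mul_smul, ← mul_assoc, inv_mul_cancel₀ hG, one_mul, f.toLinearMap_apply]

theorem matrixUnit_apply_of_isEmpty_equiv {ρ : Representation ℂ G W} {ρ' : Representation ℂ G W'}
    (hρ : ρ.IsIrreducible) (hρ' : ρ'.IsIrreducible) [IsEmpty (ρ.Equiv ρ')]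
    {σ : Representation ℂ G M} (f : IntertwiningMap ρ' σ) (ξ : Module.Dual ℂ W) (s : W) (t : W') :
    matrixUnit ρ σ ξ s (f t) = 0 := by
  rw [matrixUnit, LinearMap.smul_apply, ← f.map_functionOp,
    functionOp_matrixCoeff_of_isEmpty_equiv hρ hρ']
  rw [LinearMap.zero_apply, ← f.toLinearMap_apply, map_zero, smul_zero]

end Representation

/-! ### The isotypic decomposition -/

section Isotypic

open Representation

variable {G : Type x} [Group G] {M : Type v} [AddCommGroup M] [Module ℂ M]

theorem isEmpty_equiv_of_ne {W : irrCharacters G → Type w} [∀ χ, AddCommGroup (W χ)]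
    [∀ χ, Module ℂ (W χ)] {ρ : ∀ χ, Representation ℂ G (W χ)}
    (hchar : ∀ χ, (ρ χ).character = (χ : G → ℂ)) {χ ψ : irrCharacters G} (h : χ ≠ ψ) :
    IsEmpty ((ρ χ).Equiv (ρ ψ)) :=
  ⟨fun e => h (Subtype.ext (by rw [← hchar, ← hchar, char_iso e]))⟩

theorem evalMap_lof_tmul (σ : Representation ℂ G M) {ι : Type u} [DecidableEq ι] {W : ι → Type w}
    [∀ i, AddCommGroup (W i)] [∀ i, Module ℂ (W i)] (ρ : ∀ i, Representation ℂ G (W i)) (i : ι)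
    (s : W i) (f : IntertwiningMap (ρ i) σ) :
    evalMap σ ρ (DirectSum.lof ℂ ι (fun i => W i ⊗[ℂ] IntertwiningMap (ρ i) σ) i (s ⊗ₜ f)) =
      f s := by
  -- `evalMap` was built with classical decidability, which has to be matched with the given
  -- instance.
  rw [evalMap, Subsingleton.elim (fun i j : ι => Classical.propDecidable (i = j)) ‹DecidableEq ι›]
  simp

theorem evalMap_directSum_apply (σ : Representation ℂ G M) {ι : Type u} {W : ι → Type w}
    [∀ i, AddCommGroup (W i)] [∀ i, Module ℂ (W i)] (ρ : ∀ i, Representation ℂ G (W i)) (g : G)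
    (y) :
    evalMap σ ρ (Representation.directSum (fun i => (ρ i).tprod
      (Representation.trivial ℂ G (IntertwiningMap (ρ i) σ))) g y) = σ g (evalMap σ ρ y) := by
  classical
  suffices h : evalMap σ ρ ∘ₗ Representation.directSum (fun i => (ρ i).tprod
      (Representation.trivial ℂ G (IntertwiningMap (ρ i) σ))) g = σ g ∘ₗ evalMap σ ρ from
    LinearMap.congr_fun h y
  refine DirectSum.linearMap_ext ℂ fun i => TensorProduct.ext' fun s f => ?_
  have h : Representation.directSum (fun i => (ρ i).tprod
      (Representation.trivial ℂ G (IntertwiningMap (ρ i) σ))) g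
      (DirectSum.lof ℂ _ _ i (s ⊗ₜ f)) = DirectSum.lof ℂ _ _ i (ρ i g s ⊗ₜ f) := by
    simp [Representation.directSum]
  simp only [LinearMap.comp_apply]
  rw [h, evalMap_lof_tmul, evalMap_lof_tmul, f.isIntertwining]

/-- The coordinates of a tensor in a basis of `W` are its contractions with the coordinate
functionals. -/
theorem TensorProduct.eq_zero_of_forall_dual {W : Type w} [AddCommGroup W] [Module ℂ W]
    (t : W ⊗[ℂ] M)
    (h : ∀ ξ : Module.Dual ℂ W, TensorProduct.lid ℂ M (ξ.rTensor M t) = 0) : t = 0 := by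
  classical
  let b := Module.Basis.ofVectorSpace ℂ W
  apply (TensorProduct.equivFinsuppOfBasisLeft b (N := M)).injective
  ext i
  rw [TensorProduct.equivFinsuppOfBasisLeft_apply, h, map_zero, Finsupp.zero_apply]

variable (σ : Representation ℂ G M)
    {W : irrCharacters G → Type w} [∀ χ, AddCommGroup (W χ)] [∀ χ, Module ℂ (W χ)]
    [∀ χ, Module.Finite ℂ (W χ)] {ρ : ∀ χ, Representation ℂ G (W χ)}

theorem evalMap_surjective [Finite G] (hirr : ∀ χ, (ρ χ).IsIrreducible)
    (hchar : ∀ χ, (ρ χ).character = (χ : G → ℂ)) : Function.Surjective (evalMap σ ρ) := by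
  classical
  exact LinearMap.range_eq_top.1 <| eq_top_of_forall_apply_mem σ hirr hchar fun χ f s =>
    ⟨_, evalMap_lof_tmul σ ρ χ s f⟩

/-- Matrix units recover all contractions of all components of `y` from its image, which makes
`evalMap` injective. -/
theorem matrixUnit_evalMap [Fintype G] (hirr : ∀ χ, (ρ χ).IsIrreducible)
    (hchar : ∀ χ, (ρ χ).character = (χ : G → ℂ)) (χ : irrCharacters G)
    (ξ : Module.Dual ℂ (W χ)) (s : W χ) (y) :
    matrixUnit (ρ χ) σ ξ s (evalMap σ ρ y) =
      TensorProduct.lid ℂ (IntertwiningMap (ρ χ) σ) (ξ.rTensor _ (y χ)) s := by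
  classical
  induction y using DirectSum.induction_on with
  | zero => simp
  | of ψ t =>
    induction t using TensorProduct.induction_on with
    | zero => simp
    | tmul t f =>
      rw [← DirectSum.lof_eq_of ℂ, evalMap_lof_tmul, DirectSum.lof_eq_of]
      by_cases hχ : χ = ψ
      · subst hχ
        rw [matrixUnit_apply_self (hirr χ), DirectSum.of_eq_same]
        simp
      · have := isEmpty_equiv_of_ne hchar hχ
        rw [matrixUnit_apply_of_isEmpty_equiv (hirr χ) (hirr ψ), DirectSum.of_eq_of_ne _ _ _ hχ]
        simp
    | add s t hs ht =>
      simp only [map_add, DirectSum.add_apply, hs, ht, IntertwiningMap.coe_add, Pi.add_apply]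
  | add s t hs ht =>
    simp only [map_add, DirectSum.add_apply, hs, ht, IntertwiningMap.coe_add, Pi.add_apply]

theorem evalMap_injective [Finite G] (hirr : ∀ χ, (ρ χ).IsIrreducible)
    (hchar : ∀ χ, (ρ χ).character = (χ : G → ℂ)) : Function.Injective (evalMap σ ρ) := by
  have := Fintype.ofFinite G
  rw [injective_iff_map_eq_zero]
  intro y hy
  refine DFinsupp.ext fun χ => TensorProduct.eq_zero_of_forall_dual _ fun ξ => ?_
  ext s
  rw [IntertwiningMap.toLinearMap_apply, ← matrixUnit_evalMap σ hirr hchar, hy, map_zero]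
  rfl

/-- For the vectors of bases of the irreducible representations, the images of the multiplicity
spaces under evaluation are independent. -/
theorem iSupIndep_range_evalAt [Finite G] (hirr : ∀ χ, (ρ χ).IsIrreducible)
    (hchar : ∀ χ, (ρ χ).character = (χ : G → ℂ)) {ι : irrCharacters G → Type*}
    (b : ∀ χ, Module.Basis (ι χ) ℂ (W χ)) :
    iSupIndep fun j : Σ χ, ι χ =>
      LinearMap.range (VertexModule.evalAt σ (ρ j.1) (b j.1 j.2)) := by
  classical
  have := Fintype.ofFinite G
  rintro ⟨χ, i⟩
  rw [Submodule.disjoint_def]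
  rintro _ ⟨f, rfl⟩ h
  -- This diagonal matrix unit fixes `f (b χ i)` and kills the ranges for all other indices.
  let P := matrixUnit (ρ χ) σ ((b χ).coord i) (b χ i)
  have hle : (⨆ (j : Σ χ, ι χ) (_ : j ≠ ⟨χ, i⟩),
      LinearMap.range (VertexModule.evalAt σ (ρ j.1) (b j.1 j.2))) ≤ LinearMap.ker P := by
    refine iSup₂_le ?_
    rintro ⟨ψ, j⟩ hj _ ⟨f, rfl⟩
    change P (f (b ψ j)) = 0
    by_cases hχ : χ = ψ
    · subst hχ
      have hji : j ≠ i := fun h => hj (by rw [h])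
      rw [matrixUnit_apply_self (hirr χ)]
      simp [hji]
    · have := isEmpty_equiv_of_ne hchar hχ
      exact matrixUnit_apply_of_isEmpty_equiv (hirr χ) (hirr ψ) _ _ _ _
  have h0 : P (f (b χ i)) = 0 := hle h
  rw [matrixUnit_apply_self (hirr χ)] at h0
  change f (b χ i) = 0
  simpa using h0

theorem iSup_range_evalAt [Finite G] (hirr : ∀ χ, (ρ χ).IsIrreducible)
    (hchar : ∀ χ, (ρ χ).character = (χ : G → ℂ)) {ι : irrCharacters G → Type*}
    (b : ∀ χ, Module.Basis (ι χ) ℂ (W χ)) :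
    ⨆ j : Σ χ, ι χ, LinearMap.range (VertexModule.evalAt σ (ρ j.1) (b j.1 j.2)) = ⊤ := by
  refine eq_top_of_forall_apply_mem σ hirr hchar fun χ f s => ?_
  induction (b χ).mem_span s using Submodule.span_induction with
  | mem s hs =>
    obtain ⟨i, rfl⟩ := hs
    exact Submodule.mem_iSup_of_mem (⟨χ, i⟩ : Σ χ, ι χ) ⟨f, rfl⟩
  | zero => rw [← f.toLinearMap_apply, map_zero]; exact zero_mem _
  | add s t _ _ hs ht =>
    rw [← f.toLinearMap_apply, map_add]
    exact add_mem hs ht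
  | smul z s _ hs =>
    rw [← f.toLinearMap_apply, map_smul]
    exact Submodule.smul_mem _ z hs

end Isotypic

/-! ### Module maps and combinations of modes with recorded coefficients. -/

namespace VertexModule

variable {V : Type u} [AddCommGroup V] [Module ℂ V] {A : VertexAlgebra V}

theorem evalMap_directSum_tensor_multiplicity {G : Type x} [Group G] {M : Type v}
    [AddCommGroup M] [Module ℂ M] (X : VertexModule A M) (σ : Representation ℂ G M)
    (hσ : ∀ (g : G) (a : V) (n : ℤ) (c : M), σ g (X.Y a n c) = X.Y a n (σ g c))
    {ι : Type*} {W : ι → Type w} [∀ i, AddCommGroup (W i)] [∀ i, Module ℂ (W i)]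
    [∀ i, Module.Finite ℂ (W i)] (ρ : ∀ i, Representation ℂ G (W i)) (a : V) (n : ℤ) (y) :
    evalMap σ ρ ((VertexModule.directSum fun i =>
        (X.multiplicity σ hσ (ρ i)).tensor (W i)).Y a n y) =
      X.Y a n (evalMap σ ρ y) := by
  classical
  suffices h : evalMap σ ρ ∘ₗ (VertexModule.directSum fun i =>
        (X.multiplicity σ hσ (ρ i)).tensor (W i)).Y a n = X.Y a n ∘ₗ evalMap σ ρ from
    LinearMap.congr_fun h y
  refine DirectSum.linearMap_ext ℂ fun i => TensorProduct.ext' fun s f => ?_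
  simp only [LinearMap.comp_apply, evalMap_lof_tmul]
  simp [VertexModule.directSum, VertexModule.tensor, evalMap_lof_tmul, multiplicity]

theorem IsIrreducible.of_surjective {M : Type v} [AddCommGroup M] [Module ℂ M]
    {M' : Type w} [AddCommGroup M'] [Module ℂ M'] {X : VertexModule A M} {X' : VertexModule A M'}
    (hX : X.IsIrreducible) [Nontrivial M'] (F : M →ₗ[ℂ] M') (hF : Function.Surjective F)
    (hcomm : ∀ a n c, F (X.Y a n c) = X'.Y a n (F c)) : X'.IsIrreducible := by
  refine ⟨inferInstance, fun N hN => ?_⟩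
  have hs : X.IsStable (N.comap F) := fun a n c hc => by
    rw [Submodule.mem_comap, hcomm]
    exact hN a n _ hc
  rw [← Submodule.map_comap_eq_of_surjective hF N]
  rcases hX.2 _ hs with h | h
  · exact Or.inl (by rw [h, Submodule.map_bot])
  · exact Or.inr (by rw [h, Submodule.map_top, LinearMap.range_eq_top.2 hF])

/-- The linear combination of modes with given coefficients. -/
def modeComb {M : Type v} [AddCommGroup M] [Module ℂ M] (X : VertexModule A M)
    (r : V × ℤ →₀ ℂ) : Module.End ℂ M :=
  r.sum fun p z => z • X.Y p.1 p.2

/-- Recorded coefficients let the same combination act on different modules, so it can be carried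
along module maps. -/
theorem exists_modeComb_eq {M : Type v} [AddCommGroup M] [Module ℂ M] {X : VertexModule A M}
    {T : Module.End ℂ M} (hT : T ∈ X.modeSpan) : ∃ r, X.modeComb r = T :=
  Finsupp.mem_span_range_iff_exists_finsupp.1 hT

theorem map_modeComb {M : Type v} [AddCommGroup M] [Module ℂ M]
    {M' : Type w} [AddCommGroup M'] [Module ℂ M'] (X : VertexModule A M) (X' : VertexModule A M')
    (F : M →ₗ[ℂ] M') (hcomm : ∀ a n c, F (X.Y a n c) = X'.Y a n (F c)) (r : V × ℤ →₀ ℂ) (c : M) :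
    F (X.modeComb r c) = X'.modeComb r (F c) := by
  simp [modeComb, Finsupp.sum, hcomm]

theorem IsStable.modeComb_mem {M : Type v} [AddCommGroup M] [Module ℂ M] {X : VertexModule A M}
    {N : Submodule ℂ M} (hN : X.IsStable N) (r : V × ℤ →₀ ℂ) {c : M} (hc : c ∈ N) :
    X.modeComb r c ∈ N := by
  simp only [modeComb, Finsupp.sum, LinearMap.sum_apply, LinearMap.smul_apply]
  exact Submodule.sum_mem _ fun p _ => Submodule.smul_mem _ _ (hN _ _ _ hc)

end VertexModule

open Representation

/-! ### Linear independence of automorphisms and averaging over the group. -/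

namespace VertexAlgebra

variable {V : Type u} [AddCommGroup V] [Module ℂ V] (A : VertexAlgebra V) (G : Subgroup A.Aut)

theorem natRep_mode (g : G) (a : V) (n : ℤ) (b : V) :
    A.natRep G g (A.Y a n b) = A.Y (A.natRep G g a) n (A.natRep G g b) :=
  (g : A.Aut).2.2 a n b

theorem natRep_injective : Function.Injective (A.natRep G) := fun _ _ e =>
  Subtype.ext <| Subtype.ext <| LinearEquiv.ext fun a => LinearMap.congr_fun e a

theorem natRep_conj_mode (g : G) (a : V) (n : ℤ) (b : V) :
    A.natRep G g (A.Y a n (A.natRep G g⁻¹ b)) = A.Y (A.natRep G g a) n b := by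
  rw [natRep_mode, self_inv_apply]

theorem apply_modeComb_multiplicityModule {W : Type w} [AddCommGroup W] [Module ℂ W]
    [Module.Finite ℂ W] {ρ : Representation ℂ G W}
    (r : (A.fixed G).carrier × ℤ →₀ ℂ) (f : IntertwiningMap ρ (A.natRep G)) (s : W) :
    (A.multiplicityModule G ρ).modeComb r f s = (A.overOrbifold G).modeComb r (f s) :=
  (A.multiplicityModule G ρ).map_modeComb (A.overOrbifold G)
    (VertexModule.evalAt (A.natRep G) ρ s) (fun _ _ _ => rfl) r f

variable {A} [Fintype G]

/-- Relations between automorphisms can be multiplied by matrix coefficients. -/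
theorem functionOp_mul_matrixCoeff_eq_zero (hA : A.IsSimple)
    (hdim : Module.rank ℂ V ≤ Cardinal.aleph0) {φ : G → ℂ}
    (hφ : functionOp (A.natRep G) φ = 0) (ξ : Module.Dual ℂ V) (c : V) :
    functionOp (A.natRep G) (φ * matrixCoeff (A.natRep G) ξ c) = 0 := by
  ext d
  obtain ⟨T, hT, h⟩ := VertexModule.IsIrreducible.exists_modeSpan_eq hA hdim (ξ.smulRight d)
    (fun g : G => A.natRep G g⁻¹ c)
  -- For `T = a_n` the sum is the `n`-th mode of `∑ φ(g) g a = 0` applied to `c`. Since `T` acts as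
  -- `ξ(·) d` on the vectors `g⁻¹ c`, the same sum is the required one.
  have key : ∑ g, φ g • A.natRep G g (T (A.natRep G g⁻¹ c)) = 0 := by
    clear h
    induction hT using Submodule.span_induction with
    | mem T hT =>
      obtain ⟨⟨a, n⟩, rfl⟩ := hT
      have h := LinearMap.congr_fun hφ a
      rw [functionOp_apply] at h
      have h' := congrArg (fun a => A.Y a n c) h
      simpa [adjoint, natRep_conj_mode] using h'
    | zero => simp
    | add S T _ _ hS hT => simp [Finset.sum_add_distrib, hS, hT]
    | smul r T _ hT => simp [smul_comm _ r, ← Finset.smul_sum, hT]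
  rw [functionOp_apply, LinearMap.zero_apply, ← key]
  refine Finset.sum_congr rfl fun g _ => ?_
  rw [h]
  simp [matrixCoeff, mul_smul]

/-- Distinct automorphisms of a simple vertex algebra of countable dimension are linearly
independent. -/
theorem functionOp_natRep_injective (hA : A.IsSimple)
    (hdim : Module.rank ℂ V ≤ Cardinal.aleph0) :
    Function.Injective (functionOp (A.natRep G)) := by
  classical
  have : Nontrivial V := hA.1
  rw [injective_iff_map_eq_zero]
  intro φ hφ
  ext h
  -- Remove group elements from the support of the relation one at a time, keeping the coefficient
  -- at `h`.
  have key : ∀ s : Finset G, h ∉ s →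
      ∃ ψ, functionOp (A.natRep G) ψ = 0 ∧ ψ h = φ h ∧ ∀ g ∈ s, ψ g = 0 := by
    intro s
    induction s using Finset.induction_on with
    | empty => exact fun _ => ⟨φ, hφ, rfl, by simp⟩
    | insert k s _ ih =>
      intro hs
      rw [Finset.mem_insert, not_or] at hs
      obtain ⟨ψ, h0, h1, h2⟩ := ih hs.2
      obtain ⟨c, hc⟩ : ∃ c, A.natRep G h⁻¹ c - A.natRep G k⁻¹ c ≠ 0 := by
        by_contra! H
        exact hs.1 (inv_injective (A.natRep_injective G
          (LinearMap.ext fun c => sub_eq_zero.1 (H c))))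
      obtain ⟨ξ, hξ⟩ : ∃ ξ : Module.Dual ℂ V, ξ (A.natRep G h⁻¹ c - A.natRep G k⁻¹ c) ≠ 0 := by
        by_contra! H
        exact hc ((Module.forall_dual_apply_eq_zero_iff ℂ _).1 H)
      rw [map_sub] at hξ
      -- Multiply `ψ` by the matrix coefficient minus its value at `k`, normalized to be 1 at `h`.
      refine ⟨(ξ (A.natRep G h⁻¹ c) - ξ (A.natRep G k⁻¹ c))⁻¹ •
        (ψ * matrixCoeff (A.natRep G) ξ c - ξ (A.natRep G k⁻¹ c) • ψ), ?_, ?_, ?_⟩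
      · rw [map_smul, map_sub, map_smul, functionOp_mul_matrixCoeff_eq_zero G hA hdim h0, h0]
        simp
      · simp only [Pi.smul_apply, Pi.sub_apply, Pi.mul_apply, smul_eq_mul, matrixCoeff, h1]
        field_simp
      · intro g hg
        simp only [Pi.smul_apply, Pi.sub_apply, Pi.mul_apply, smul_eq_mul, matrixCoeff]
        rcases Finset.mem_insert.1 hg with rfl | hg
        · ring
        · rw [h2 g hg]
          ring
  obtain ⟨ψ, h0, h1, h2⟩ := key (Finset.univ.erase h) (by simp)
  obtain ⟨c, hc⟩ := exists_ne (0 : V)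
  have h3 := LinearMap.congr_fun h0 (A.natRep G h⁻¹ c)
  rw [functionOp_apply, Finset.sum_eq_single_of_mem h (Finset.mem_univ _)
    (fun g _ hg => by rw [h2 g (by simp [hg]), zero_smul]), self_inv_apply,
    LinearMap.zero_apply, h1] at h3
  exact (smul_eq_zero.1 h3).resolve_right hc

/-- By linear independence the matrix coefficient vanishes identically; its value at the identity is
`ξ s`. -/
theorem dual_apply_eq_zero_of_functionOp_matrixCoeff_eq_zero (hA : A.IsSimple)
    (hdim : Module.rank ℂ V ≤ Cardinal.aleph0) {W : Type w}
    [AddCommGroup W] [Module ℂ W] {ρ : Representation ℂ G W} {ξ : Module.Dual ℂ W} {s : W}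
    (h : functionOp (A.natRep G) (matrixCoeff ρ ξ s) = 0) : ξ s = 0 := by
  have h1 := functionOp_natRep_injective G hA hdim (h.trans (map_zero _).symm)
  simpa [matrixCoeff] using congrFun h1 1

/-- The conjugates of `a_n` sum to the `n`-th mode of `∑ g a`, which is a fixed vector. -/
theorem sum_conj_mem_modeSpan_overOrbifold {T : Module.End ℂ V} (hT : T ∈ A.adjoint.modeSpan) :
    ∑ g, A.natRep G g ∘ₗ T ∘ₗ A.natRep G g⁻¹ ∈ (A.overOrbifold G).modeSpan := by
  induction hT using Submodule.span_induction with
  | mem T hT =>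
    obtain ⟨⟨a, n⟩, rfl⟩ := hT
    let a' : (A.fixed G).carrier := ⟨∑ g, A.natRep G g a, fun h => by
      rw [map_sum]
      exact Fintype.sum_equiv (_root_.Equiv.mulLeft h) _ _ fun g => by simp⟩
    convert (A.overOrbifold G).mode_mem_modeSpan a' n using 1
    ext c
    simp [adjoint, natRep_conj_mode, overOrbifold, VertexModule.restrict, a']
  | zero => simp
  | add S T _ _ hS hT =>
    simpa [LinearMap.add_comp, LinearMap.comp_add, Finset.sum_add_distrib] using add_mem hS hT
  | smul r T _ hT =>
    simpa [LinearMap.smul_comp, LinearMap.comp_smul, Finset.smul_sum]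
      using Submodule.smul_mem _ r hT

/-- On finitely many vectors, an equivariant operator agrees with a linear combination of modes
of the fixed point algebra. -/
theorem exists_modeSpan_overOrbifold_eq (hA : A.IsSimple)
    (hdim : Module.rank ℂ V ≤ Cardinal.aleph0) (φ : Module.End ℂ V) {ι : Type x} [Finite ι]
    (c d : ι → V) (h : ∀ g i, φ (A.natRep G g (c i)) = A.natRep G g (d i)) :
    ∃ T ∈ (A.overOrbifold G).modeSpan, ∀ i, T (c i) = d i := by
  -- Density is applied to the whole orbits of the `c i`, so that each `g T g⁻¹` sends `c i` to `d
  -- i`, and so does their average.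
  obtain ⟨T, hT, hTφ⟩ := VertexModule.IsIrreducible.exists_modeSpan_eq hA hdim φ
    (fun p : G × ι => A.natRep G p.1 (c p.2))
  refine ⟨(Fintype.card G : ℂ)⁻¹ • _, Submodule.smul_mem _ _
    (sum_conj_mem_modeSpan_overOrbifold G hT), fun i => ?_⟩
  have hterm : ∀ g : G, A.natRep G g (T (A.natRep G g⁻¹ (c i))) = d i := fun g => by
    rw [hTφ (g⁻¹, i), h, self_inv_apply]
  simp only [LinearMap.smul_apply, LinearMap.sum_apply, LinearMap.comp_apply, hterm,
    Finset.sum_const, Finset.card_univ]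
  rw [← Nat.cast_smul_eq_nsmul ℂ, inv_smul_smul₀ (by simp)]

/-! ### Irreducibility and inequivalence of the multiplicity modules. -/

variable {W : Type w} [AddCommGroup W] [Module ℂ W] [Module.Finite ℂ W]
  {ρ : Representation ℂ G W}

/-- Any nonzero `f` generates: it is injective, and for a linear left inverse `L` the operator `h ∘
L` is equivariant on the image of `f` and takes `f` to `h`. `L` itself need not be equivariant. -/
theorem isIrreducible_multiplicityModule (hA : A.IsSimple)
    (hdim : Module.rank ℂ V ≤ Cardinal.aleph0) (hρ : ρ.IsIrreducible)
    [Nontrivial (IntertwiningMap ρ (A.natRep G))] :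
    (A.multiplicityModule G ρ).IsIrreducible := by
  refine ⟨inferInstance, fun N hN => or_iff_not_imp_left.2 fun hne => ?_⟩
  obtain ⟨f, hf, hf0⟩ := (Submodule.ne_bot_iff _).1 hne
  have hinj := (IsIrreducible.injective_or_eq_zero f).resolve_right hf0
  obtain ⟨L, hL⟩ := f.toLinearMap.exists_leftInverse_of_injective (LinearMap.ker_eq_bot.2 hinj)
  have hL : ∀ s, L (f s) = s := LinearMap.congr_fun hL
  refine (Submodule.eq_top_iff').2 fun h => ?_
  let b := Module.finBasis ℂ W
  obtain ⟨T, hT, hTb⟩ := exists_modeSpan_overOrbifold_eq G hA hdim (h.toLinearMap ∘ₗ L)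
    (fun i => f (b i)) (fun i => h (b i)) fun g i => by
      simp [← f.isIntertwining, ← h.isIntertwining, hL]
  obtain ⟨r, rfl⟩ := VertexModule.exists_modeComb_eq hT
  have hr : (A.multiplicityModule G ρ).modeComb r f = h :=
    IntertwiningMap.ext (b.ext fun i => by
      simpa [apply_modeComb_multiplicityModule] using hTb i)
  rw [← hr]
  exact hN.modeComb_mem r hf

/-- If the representations were inequivalent, some combination of modes of `V^G` would fix `f` and
kill `e f`, forcing `e f = 0`. -/
theorem nonempty_equiv_of_isIsomorphic (hA : A.IsSimple)
    (hdim : Module.rank ℂ V ≤ Cardinal.aleph0) {W' : Type w} [AddCommGroup W'] [Module ℂ W']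
    [Module.Finite ℂ W'] {ρ' : Representation ℂ G W'} (hρ : ρ.IsIrreducible)
    (hρ' : ρ'.IsIrreducible) [Nontrivial (IntertwiningMap ρ (A.natRep G))]
    (h : (A.multiplicityModule G ρ).IsIsomorphic (A.multiplicityModule G ρ')) :
    Nonempty (ρ.Equiv ρ') := by
  by_contra hne
  rw [not_nonempty_iff] at hne
  obtain ⟨e, he⟩ := h
  obtain ⟨f, hf⟩ := exists_ne (0 : IntertwiningMap ρ (A.natRep G))
  let b := Module.finBasis ℂ W
  let b' := Module.finBasis ℂ W'
  -- The sum of the diagonal matrix units is the projection onto the `ρ`-isotypic part.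
  let φ : Module.End ℂ V := ∑ i, matrixUnit ρ (A.natRep G) (b.coord i) (b i)
  have h1 : ∀ s, φ (f s) = f s := fun s => by
    simp only [φ, LinearMap.sum_apply, matrixUnit_apply_self hρ, Module.Basis.coord_apply]
    conv_rhs => rw [← b.sum_repr s, ← f.toLinearMap_apply, map_sum]
    simp
  have h2 : ∀ s, φ (e f s) = 0 := fun s => by
    simp only [φ, LinearMap.sum_apply, matrixUnit_apply_of_isEmpty_equiv hρ hρ',
      Finset.sum_const_zero]
  obtain ⟨T, hT, hTb⟩ := exists_modeSpan_overOrbifold_eq G hA hdim φ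
    (Sum.elim (fun i => f (b i)) (fun i => e f (b' i))) (Sum.elim (fun i => f (b i)) 0) (by
      rintro g (i | i)
      · simp [← IntertwiningMap.isIntertwining, h1]
      · simp [← IntertwiningMap.isIntertwining, h2])
  obtain ⟨r, rfl⟩ := VertexModule.exists_modeComb_eq hT
  have hr : (A.multiplicityModule G ρ).modeComb r f = f :=
    IntertwiningMap.ext (b.ext fun i => by
      simpa [apply_modeComb_multiplicityModule] using hTb (Sum.inl i))
  have hr' : (A.multiplicityModule G ρ').modeComb r (e f) = 0 :=
    IntertwiningMap.ext (b'.ext fun i => by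
      simpa [apply_modeComb_multiplicityModule] using hTb (Sum.inr i))
  have h3 := (A.multiplicityModule G ρ).map_modeComb (A.multiplicityModule G ρ') e.toLinearMap
    he r f
  rw [hr] at h3
  exact hf (e.map_eq_zero_iff.1 (h3.trans hr'))

end VertexAlgebra

theorem Representation.IsIrreducible.nontrivial_space {G : Type x} [Group G] {W : Type w}
    [AddCommGroup W] [Module ℂ W] {ρ : Representation ℂ G W} (hρ : ρ.IsIrreducible) :
    Nontrivial W := by
  by_contra h
  rw [not_nontrivial_iff_subsingleton] at h
  exact bot_ne_top (α := Subrepresentation ρ)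
    (Subrepresentation.toSubmodule_injective (Subsingleton.elim _ _))

/-! ### Occurrence of all irreducible representations and complete reducibility. -/

namespace VertexAlgebra

variable {V : Type u} [AddCommGroup V] [Module ℂ V] {A : VertexAlgebra V} (G : Subgroup A.Aut)
  [Finite G] {W : irrCharacters G → Type w} [∀ χ, AddCommGroup (W χ)] [∀ χ, Module ℂ (W χ)]
  [∀ χ, Module.Finite ℂ (W χ)] {ρ : ∀ χ, Representation ℂ G (W χ)}

/-- Every irreducible representation occurs in a simple vertex algebra of countable dimension. -/
theorem nontrivial_intertwiningMap (hA : A.IsSimple) (hdim : Module.rank ℂ V ≤ Cardinal.aleph0)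
    (hirr : ∀ χ, (ρ χ).IsIrreducible) (hchar : ∀ χ, (ρ χ).character = (χ : G → ℂ))
    (χ : irrCharacters G) : Nontrivial (IntertwiningMap (ρ χ) (A.natRep G)) := by
  have := Fintype.ofFinite G
  have := (hirr χ).nontrivial_space
  by_contra hn
  rw [not_nontrivial_iff_subsingleton] at hn
  obtain ⟨s, hs⟩ := exists_ne (0 : W χ)
  refine hs ((Module.forall_dual_apply_eq_zero_iff ℂ s).1 fun ξ =>
    dual_apply_eq_zero_of_functionOp_matrixCoeff_eq_zero (ρ := ρ χ) G hA hdim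
      (LinearMap.ker_eq_top.1 ?_))
  -- The operator of a matrix coefficient of `ρ χ` kills the images of all `W ψ`: for `ψ ≠ χ` by
  -- Schur's lemma, for `ψ = χ` because there are no nonzero maps.
  refine eq_top_of_forall_apply_mem (A.natRep G) hirr hchar fun ψ f t => ?_
  rw [LinearMap.mem_ker]
  by_cases h : χ = ψ
  · subst h
    rw [Subsingleton.elim f 0]
    exact map_zero _
  · have := isEmpty_equiv_of_ne hchar h
    rw [← f.map_functionOp, functionOp_matrixCoeff_of_isEmpty_equiv (hirr χ) (hirr ψ)]
    exact map_zero f.toLinearMap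

/-- `V` is the direct sum of the images of the multiplicity modules under evaluation at basis
vectors of the `W χ`. Each is a nonzero quotient of an irreducible module, since a nonzero
intertwiner is injective on `W χ`. -/
theorem isCompletelyReducible_overOrbifold (hA : A.IsSimple)
    (hdim : Module.rank ℂ V ≤ Cardinal.aleph0)
    (hirr : ∀ χ, (ρ χ).IsIrreducible) (hchar : ∀ χ, (ρ χ).character = (χ : G → ℂ)) :
    (A.overOrbifold G).IsCompletelyReducible := by
  have := Fintype.ofFinite G
  let b := fun χ => Module.finBasis ℂ (W χ)
  let N := fun j : Σ χ, Fin (Module.finrank ℂ (W χ)) =>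
    LinearMap.range (VertexModule.evalAt (A.natRep G) (ρ j.1) (b j.1 j.2))
  refine ⟨Set.range N, ?_, (iSupIndep_range_evalAt (A.natRep G) hirr hchar b).sSupIndep_range,
    (sSup_range (f := N)).trans (iSup_range_evalAt (A.natRep G) hirr hchar b)⟩
  rintro _ ⟨⟨χ, i⟩, rfl⟩
  have hN : (A.overOrbifold G).IsStable (N ⟨χ, i⟩) := by
    rintro a n _ ⟨f, rfl⟩
    exact ⟨(A.multiplicityModule G (ρ χ)).Y a n f, rfl⟩
  have := nontrivial_intertwiningMap G hA hdim hirr hchar χ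
  have : Nontrivial (N ⟨χ, i⟩) := by
    obtain ⟨f, hf⟩ := exists_ne (0 : IntertwiningMap (ρ χ) (A.natRep G))
    have hirr := hirr χ
    have hinj := (IsIrreducible.injective_or_eq_zero f).resolve_right hf
    refine ⟨⟨f (b χ i), f, rfl⟩, 0, fun h => (b χ).ne_zero i (hinj ?_)⟩
    exact (congrArg Subtype.val h).trans (map_zero f.toLinearMap).symm
  exact ⟨hN, (isIrreducible_multiplicityModule G hA hdim (hirr χ)).of_surjective
    (VertexModule.evalAt (A.natRep G) (ρ χ) (b χ i)).rangeRestrict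
    (LinearMap.surjective_rangeRestrict _) fun _ _ _ => rfl⟩

end VertexAlgebra

end

theorem theorem5 {V : Type*} [AddCommGroup V] [Module ℂ V]
    (A : VertexAlgebra V) (hA : A.IsSimple) (hdim : Module.rank ℂ V ≤ Cardinal.aleph0)
    (G : Subgroup A.Aut) [Finite G]
    (W : irrCharacters G → Type*) [∀ χ, AddCommGroup (W χ)] [∀ χ, Module ℂ (W χ)]
    [∀ χ, Module.Finite ℂ (W χ)] (ρ : ∀ χ, Representation ℂ G (W χ))
    (hirr : ∀ χ, (ρ χ).IsIrreducible) (hchar : ∀ χ, (ρ χ).character = (χ : G → ℂ)) :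
    -- the actions of `G` and `V^G` on `V` commute
    (∀ (g : G) (a : (A.fixed G).carrier) (n : ℤ) (c : V),
      A.natRep G g ((A.overOrbifold G).Y a n c) = (A.overOrbifold G).Y a n (A.natRep G g c)) ∧
    -- the decomposition of `V` as a module for `ℂ[G]` and `V^G`
    (Function.Bijective (evalMap (A.natRep G) ρ) ∧
      (∀ (g : G) x, evalMap (A.natRep G) ρ
          (Representation.directSum (fun χ => (ρ χ).tprod
            (Representation.trivial ℂ G
              (Representation.IntertwiningMap (ρ χ) (A.natRep G)))) g x) =
        A.natRep G g (evalMap (A.natRep G) ρ x)) ∧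
      (∀ (a : (A.fixed G).carrier) (n : ℤ) x, evalMap (A.natRep G) ρ
          ((VertexModule.directSum fun χ =>
            (A.multiplicityModule G (ρ χ)).tensor (W χ)).Y a n x) =
        (A.overOrbifold G).Y a n (evalMap (A.natRep G) ρ x))) ∧
    -- the multiplicity spaces are nonzero
    (∀ χ, Nontrivial (Representation.IntertwiningMap (ρ χ) (A.natRep G))) ∧
    -- they are irreducible
    (∀ χ, (A.multiplicityModule G (ρ χ)).IsIrreducible) ∧
    -- they are isomorphic only for equal characters
    (∀ χ ψ, (A.multiplicityModule G (ρ χ)).IsIsomorphic (A.multiplicityModule G (ρ ψ)) ↔ χ = ψ) ∧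
    -- `V` is completely reducible
    (A.overOrbifold G).IsCompletelyReducible := by
  exact ⟨A.natRep_comm G,
    ⟨⟨evalMap_injective _ hirr hchar, evalMap_surjective _ hirr hchar⟩,
      evalMap_directSum_apply _ _,
      (A.overOrbifold G).evalMap_directSum_tensor_multiplicity _ (A.natRep_comm G) ρ⟩,
    VertexAlgebra.nontrivial_intertwiningMap G hA hdim hirr hchar,
    fun χ => by
      have := Fintype.ofFinite G
      have := VertexAlgebra.nontrivial_intertwiningMap G hA hdim hirr hchar χ
      exact VertexAlgebra.isIrreducible_multiplicityModule G hA hdim (hirr χ),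
    fun χ ψ => by
      have := Fintype.ofFinite G
      have := VertexAlgebra.nontrivial_intertwiningMap G hA hdim hirr hchar χ
      refine ⟨fun h => ?_, ?_⟩
      · by_contra hne
        obtain ⟨e⟩ := VertexAlgebra.nonempty_equiv_of_isIsomorphic G hA hdim (hirr χ) (hirr ψ) h
        exact (isEmpty_equiv_of_ne hchar hne).false e
      · rintro rfl
        exact ⟨LinearEquiv.refl ℂ _, fun _ _ _ => rfl⟩,
    VertexAlgebra.isCompletelyReducible_overOrbifold G hA hdim hirr hchar⟩
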